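/- Fix the following conventions. All machines are Turing machines with finitely many work tapes, and time is measured as a function of the input length $n$, up to constant factors. $\mathsf{P}=\bigcup_{k>0}\mathsf{DTIME}(n^k)$. For a class $\mathcal{C}$ of languages over $\{0,1\}$, $\mathsf{NP}^{\mathcal{C}}$ (respectively $\mathsf{NEXP}^{\mathcal{C}}$) is the class of languages decided by a nondeterministic oracle Turing machine, with some language of $\mathcal{C}$ as its oracle, in time $O(n^k)$ (respectively $O(2^{n^k})$) for some $k>0$. Let $\Sigma_0^{\mathsf{P}}=\mathsf{P}$, $\Sigma_{i+1}^{\mathsf{P}}=\mathsf{NP}^{\Sigma_i^{\mathsf{P}}}$, and, for $i>0$, let $\Sigma_i^{\mathsf{EXP}}=\mathsf{NEXP}^{\Sigma_{i-1}^{\mathsf{P}}}$ (the $i$-th level of the weak EXP hierarchy). Lemma. For every $i>0$, a language $L\subseteq\{0,1\}^*$ is in $\Sigma_i^{\mathsf{EXP}}$ if and only if there exist a polynomial $q$ with coefficients in $\mathbb{N}$ and a predicate $R\subseteq(\{0,1\}^*)^{i+1}$ such that $R(w,w_1,\ldots,w_i)$ can be decided in deterministic polynomial time (in the total length of $w,w_1,\ldots,w_i$)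 and, for every $n$ and every $w\in\{0,1\}^n$, $$w\in L\iff \exists w_1\in\{0,1\}^{2^{q(n)}}.\,\forall w_2\in\{0,1\}^{2^{q(n)}}\cdots Q_i w_i\in\{0,1\}^{2^{q(n)}}.\ R(w,w_1,\ldots,w_i),$$ where the quantifiers alternate, so that $Q_i=\exists$ if $i$ is odd and $Q_i=\forall$ if $i$ is even. -/

import Mathlib

namespace WeakEXP

/-! ### Oracle Turing machines

As in Mathlib's `Turing.FinTM2`, the work tapes are stacks: a tape with a head is a pair of stacks
(the part to the left of the head, the part from the head onwards), and one step of a multi-tape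
machine is a bounded number of stack operations and conversely.  The stacks hold bits; the empty
stack (blank) is detected, so that a cell shows `0`, `1` or blank.  Larger alphabets are spread over
several stacks that are operated in parallel. -/

/-- An operation on one stack. -/
inductive StackOp where
  | keep
  | pop
  | push (b : Bool)

/-- The effect of an operation on a stack, whose top is the head of the list. -/
def StackOp.apply : StackOp → List Bool → List Bool
  | keep, s => s
  | pop, s => s.tail
  | push b, s => b :: s

/-- What a machine with stacks `K` and control states `Q` does in a given state:
* `accept`, `reject`: halt;
* `query yes no`: ask the oracle whether the word on the query stack belongs to it, and continue
  in state `yes` or `no` accordingly;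
* `move δ`: look at the tops of all stacks (`none` for an empty stack), make a nondeterministic
  choice of one bit, and pass to a new state with one operation on each stack. -/
inductive Instr (K Q : Type) where
  | accept
  | reject
  | query (yes no : Q)
  | move (δ : (K → Option Bool) → Bool → Q × (K → StackOp))

/-- A nondeterministic oracle machine with finitely many stacks and control states. -/
structure Machine where
  /-- the stacks -/
  K : Type
  /-- the states of the finite control -/
  Q : Type
  [finK : Finite K]
  [finQ : Finite Q]
  /-- the stack that initially holds the input -/
  inputStack : K
  /-- the stack on which oracle queries are written -/
  queryStack : K
  /-- the initial state -/
  start : Q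
  /-- the program -/
  instr : Q → Instr K Q

namespace Machine

/-- A configuration: a control state and the contents of the stacks. -/
structure Cfg (M : Machine) where
  /-- the control state -/
  state : M.Q
  /-- the contents of the stacks -/
  stk : M.K → List Bool

open Classical in
/-- The initial configuration on input `w`: the word `w` on the input stack (first letter on top),
all other stacks empty. -/
noncomputable def init (M : Machine) (w : List Bool) : M.Cfg where
  state := M.start
  stk := fun k => if k = M.inputStack then w else []

open Classical in
/-- One step of `M` with oracle `A` under the nondeterministic choice `b`;
`none` if `M` has halted. -/
noncomputable def next (M : Machine) (A : Language Bool) (b : Bool) (c : M.Cfg) : Option M.Cfg :=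
  match M.instr c.state with
  | .accept => none
  | .reject => none
  | .query yes no => some ⟨if c.stk M.queryStack ∈ A then yes else no, c.stk⟩
  | .move δ =>
      let r := δ (fun k => (c.stk k).head?) b
      some ⟨r.1, fun k => (r.2 k).apply (c.stk k)⟩

/-- The configuration after `bs.length` steps from `c` along the choices `bs`;
`none` if `M` halts earlier. -/
noncomputable def run (M : Machine) (A : Language Bool) : List Bool → M.Cfg → Option M.Cfg
  | [], c => some c
  | b :: bs, c => (M.next A b c).bind (M.run A bs)

/-- Some computation of `M` with oracle `A` on input `w` ends in an accepting state. -/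
def Accepts (M : Machine) (A : Language Bool) (w : List Bool) : Prop :=
  ∃ (bs : List Bool) (c : M.Cfg), M.run A bs (M.init w) = some c ∧ M.instr c.state = .accept

/-- Every computation of `M` with oracle `A` on input `w` halts after at most `t` steps. -/
def HaltsWithin (M : Machine) (A : Language Bool) (w : List Bool) (t : ℕ) : Prop :=
  ∀ bs : List Bool, (M.run A bs (M.init w)).isSome → bs.length ≤ t

/-- `M` with oracle `A` decides `L` in time `O(t)`, where `t` is a function of the input length. -/
def DecidesInTime (M : Machine) (A : Language Bool) (L : Language Bool) (t : ℕ → ℕ) : Prop :=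
  (∀ w : List Bool, w ∈ L ↔ M.Accepts A w) ∧
    ∃ c : ℕ, ∀ w : List Bool, M.HaltsWithin A w (c * t w.length + c)

/-- The moves of `M` do not depend on the nondeterministic choices. -/
def Deterministic (M : Machine) : Prop :=
  ∀ q δ, M.instr q = .move δ → ∀ tops, δ tops false = δ tops true

/-- `M` never queries the oracle. -/
def OracleFree (M : Machine) : Prop :=
  ∀ q yes no, M.instr q ≠ .query yes no

end Machine

/-! ### Complexity classes -/

/-- `DTIME(t)`. The oracle is irrelevant, as the machine makes no queries. -/
def DTIME (t : ℕ → ℕ) : Set (Language Bool) :=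
  {L | ∃ M : Machine, M.Deterministic ∧ M.OracleFree ∧ M.DecidesInTime 0 L t}

/-- `NTIME(t)` relative to the oracle `A`. -/
def NTIME (A : Language Bool) (t : ℕ → ℕ) : Set (Language Bool) :=
  {L | ∃ M : Machine, M.DecidesInTime A L t}

/-- `P`, the union of the classes `DTIME(n ^ k)` over `k > 0`. -/
def P : Set (Language Bool) := {L | ∃ k > 0, L ∈ DTIME (fun n => n ^ k)}

/-- `EXP`, the union of the classes `DTIME(2 ^ (n ^ k))` over `k > 0`. -/
def EXP : Set (Language Bool) := {L | ∃ k > 0, L ∈ DTIME (fun n => 2 ^ (n ^ k))}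

/-- `NP` relative to a class `C`: some language of `C` serves as the oracle. -/
def NP (C : Set (Language Bool)) : Set (Language Bool) :=
  {L | ∃ A ∈ C, ∃ k > 0, L ∈ NTIME A (fun n => n ^ k)}

/-- `NEXP` relative to a class `C`: some language of `C` serves as the oracle. -/
def NEXP (C : Set (Language Bool)) : Set (Language Bool) :=
  {L | ∃ A ∈ C, ∃ k > 0, L ∈ NTIME A (fun n => 2 ^ (n ^ k))}

/-- The levels `Σ_i^P` of the polynomial-time hierarchy. -/
def SigmaP : ℕ → Set (Language Bool)
  | 0 => P
  | i + 1 => NP (SigmaP i)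

/-- The levels `Σ_i^EXP` of the weak EXP hierarchy. -/
def SigmaEXP : ℕ → Set (Language Bool)
  | 0 => EXP
  | i + 1 => NEXP (SigmaP i)

/-! ### Polynomial-time predicates on tuples, and alternating bounded quantifiers -/

/-- Self-delimiting code of a word: each bit is preceded by a `1`, and a `0` marks the end. -/
def encodeWord (u : List Bool) : List Bool :=
  u.flatMap (fun b => [true, b]) ++ [false]

/-- The code of a tuple of words. -/
def encodeTuple {k : ℕ} (x : Fin k → List Bool) : List Bool :=
  (List.ofFn x).flatMap encodeWord

/-- The predicate `R` on `k`-tuples of words is decidable in deterministic polynomial time. -/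
def PolyTimeDecidable {k : ℕ} (R : (Fin k → List Bool) → Prop) : Prop :=
  ({u | ∃ x, u = encodeTuple x ∧ R x} : Language Bool) ∈ P

/-- `AltQuant ℓ true k φ` is the statement `∃ u₁ ∀ u₂ ∃ u₃ ⋯ Q u_k, φ (u₁, …, u_k)`, where the `u_j`
range over the bit strings of length `ℓ`; `AltQuant ℓ false k φ` is the same with the quantifiers
starting with `∀`. -/
def AltQuant (ℓ : ℕ) : Bool → (k : ℕ) → ((Fin k → List Bool) → Prop) → Prop
  | _, 0, φ => φ ![]
  | true, k + 1, φ =>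
      ∃ u : List Bool, u.length = ℓ ∧ AltQuant ℓ false k (fun v => φ (Matrix.vecCons u v))
  | false, k + 1, φ =>
      ∀ u : List Bool, u.length = ℓ → AltQuant ℓ true k (fun v => φ (Matrix.vecCons u v))

end WeakEXP

/-! Certificates carry the passage from machines to quantifiers. Let a machine with an oracle `A` in
Σ_j^P decide `L` in time t. Then w ∈ L iff w has a correct transcript of an accepting computation,
listing for each step the oracle's answer, the choice bit and, after a positive answer, a
certificate that the queried word lies in `A`. The invalid transcripts again form a language of
Σ_j^P: either the replay does not end in acceptance, or some positive answer carries an invalid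
certificate, or some negative answer concerns a word that has a valid one. The position of the wrong
entry and the overlooked certificate can be guessed, and a single query to the language of invalid
certificates one level below settles the matter. This is the induction step
`Verifiable.of_mem_NTIME`; for j = 0 the verifier recomputes the oracle's answers and needs only the
choices (`verifiable_of_mem_NTIME_P`).

The time bound t is arbitrary here: transcripts have length polynomial in |w| + t(|w|), while their
verification is measured in the length of the transcript itself. With polynomial t this gives the
quantifier description of Σ_j^P (`exists_altQuant_of_mem_SigmaP`); with t = 2^(n^k) it puts one
exponentially long witness in front of such a description (`exists_altQuant_of_verifiable`). All
quantifiers can share one length because the descriptions hold for every sufficiently large length.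

Conversely, a machine produces a word of length 2^q(n) by repeated doubling (`exists_comp_two_pow`),
guesses w₁ of that length and asks one question to the language expressing the other quantifiers.
There the length is given in unary, so that language is in Σ_j^P (`altLanguage_mem_SigmaP`).

Underneath lies a small theory of polynomial time: while programs compile into machines
(`run_of_exec`, `mem_P_of_polyPred`, `guess_mem_NTIME`), and machine steps are in turn
polynomial-time functions of configurations (`Poly.simStep`, `polyPred_of_mem_P`). -/

open Function

namespace WeakEXP

/-! ### Structured deterministic programs on registers -/

/-- Deterministic while programs operating on stacks indexed by `ℕ`. -/
inductive Prog where
  | op (r : ℕ) (o : StackOp)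
  | seq (p q : Prog)
  | case (r : ℕ) (br : Option Bool → Prog)
  | loop (r : ℕ) (c : Option Bool → Bool) (p : Prog)

/-- `Exec p s s' t`: started with the stacks `s`, the program `p` ends after `t` steps
with the stacks `s'`. -/
inductive Exec : Prog → (ℕ → List Bool) → (ℕ → List Bool) → ℕ → Prop
  | op (r o s) : Exec (.op r o) s (update s r (o.apply (s r))) 1
  | seq {p q s s' s'' t t'} : Exec p s s' t → Exec q s' s'' t' → Exec (.seq p q) s s'' (t + t')
  | case {r br s s' t} : Exec (br (s r).head?) s s' t → Exec (.case r br) s s' (t + 1)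
  | loop_end {r c p s} : c (s r).head? = false → Exec (.loop r c p) s s 1
  | loop_continue {r c p s s' s'' t t'} : c (s r).head? = true → Exec p s s' t →
      Exec (.loop r c p) s' s'' t' → Exec (.loop r c p) s s'' (t + t' + 1)

theorem Exec.cast {p s s' s'' t t'} (h : Exec p s s' t) (hs : s' = s'') (ht : t = t') :
    Exec p s s'' t' := hs ▸ ht ▸ h

theorem StackOp.length_apply (o : StackOp) (l : List Bool) :
    (o.apply l).length ≤ l.length + 1 := by
  cases o <;> simp [StackOp.apply] ; omega

/-- One step pushes at most one letter. This is why outputs of polynomial-time programs are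
polynomially long, and hence why such programs compose. -/
theorem Exec.length_le {p s s' t} (h : Exec p s s' t) (r : ℕ) :
    (s' r).length ≤ (s r).length + t := by
  induction h with
  | op r' o s =>
    by_cases hr : r = r'
    · subst hr; simpa using StackOp.length_apply o (s r)
    · simp [hr]
  | seq _ _ h₁ h₂ => omega
  | case _ h => omega
  | loop_end _ => omega
  | loop_continue _ _ _ h₁ h₂ => omega

/-! ### Programs as parts of machines -/

namespace Prog

/-- The control positions in a program. -/
def Pos : Prog → Type
  | op _ _ => Unit
  | seq p q => Pos p ⊕ Pos q
  | case _ br => Option (Σ o, Pos (br o))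
  | loop _ _ p => Option (Pos p)

instance finite_pos : (p : Prog) → Finite p.Pos
  | op _ _ => inferInstanceAs (Finite Unit)
  | seq p q => by
    have := finite_pos p
    have := finite_pos q
    exact inferInstanceAs (Finite (Pos p ⊕ Pos q))
  | case _ br => by
    have := fun o => finite_pos (br o)
    exact inferInstanceAs (Finite (Option (Σ o, Pos (br o))))
  | loop _ _ p => by
    have := finite_pos p
    exact inferInstanceAs (Finite (Option (Pos p)))

/-- The position where the execution starts. -/
def entry : (p : Prog) → p.Pos
  | op _ _ => ()
  | seq p _ => Sum.inl (entry p)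
  | case _ _ => (none : Option _)
  | loop _ _ _ => (none : Option _)

/-- One step of a program whose positions are embedded by `e` in the states of a machine that
continues with the state `x` after the execution of the program. -/
def step {X : Type} : (p : Prog) → (p.Pos → X) → X → p.Pos → (ℕ → Option Bool) →
    X × (ℕ → StackOp)
  | op r o, _, x, _, _ => (x, fun k => if k = r then o else .keep)
  | seq p q, e, _, Sum.inl y, tops =>
      step p (fun z => e (Sum.inl z)) (e (Sum.inr (entry q))) y tops
  | seq _ q, e, x, Sum.inr y, tops => step q (fun z => e (Sum.inr z)) x y tops
  | case r br, e, _, none, tops =>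
      (e (some ⟨tops r, entry (br (tops r))⟩ : Option _), fun _ => .keep)
  | case _ br, e, x, some ⟨o, y⟩, tops =>
      step (br o) (fun z => e (some ⟨o, z⟩ : Option _)) x y tops
  | loop r c p, e, x, none, tops =>
      (if c (tops r) then e (some (entry p) : Option _) else x, fun _ => .keep)
  | loop _ _ p, e, _, some y, tops =>
      step p (fun z => e (some z : Option _)) (e (none : Option _)) y tops

/-- A strict upper bound for the registers of a program. -/
def bound : Prog → ℕ
  | op r _ => r + 1
  | seq p q => max (bound p) (bound q)
  | case r br => max (r + 1) (max (bound (br none)) (max (bound (br (some false)))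
      (bound (br (some true)))))
  | loop r _ p => max (r + 1) (bound p)

end Prog

/-- The machine with stacks `0, …, N`, of which stack `0` holds the input and the queries. -/
@[reducible] def stackMachine (N : ℕ) (Q : Type) [Finite Q] (start : Q)
    (instr : Q → Instr (Fin (N + 1)) Q) : Machine where
  K := Fin (N + 1)
  Q := Q
  inputStack := 0
  queryStack := 0
  start := start
  instr := instr

/-- The tops of finitely many stacks, extended by `none`. -/
def extendTops {N : ℕ} (tops : Fin (N + 1) → Option Bool) (k : ℕ) : Option Bool :=
  if h : k < N + 1 then tops ⟨k, h⟩ else none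

/-- The program `p` is embedded by `e` in the program `instr`, which continues with `x`. -/
def Embeds {N : ℕ} {Q : Type} (instr : Q → Instr (Fin (N + 1)) Q) (p : Prog) (e : p.Pos → Q)
    (x : Q) : Prop :=
  ∀ y, instr (e y) = .move (fun tops _ =>
    ((p.step e x y (extendTops tops)).1, fun k => (p.step e x y (extendTops tops)).2 k))

namespace Machine

theorem run_append (M : Machine) (A : Language Bool) (bs bs' : List Bool) (c : M.Cfg) :
    M.run A (bs ++ bs') c = (M.run A bs c).bind (M.run A bs') := by
  induction bs generalizing c with
  | nil => simp [run]
  | cons b bs ih =>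
    simp only [List.cons_append, run]
    cases M.next A b c <;> simp [ih]

theorem run_append_of_eq {M : Machine} {A : Language Bool} {bs bs' : List Bool} {c c' : M.Cfg}
    (h : M.run A bs c = some c') : M.run A (bs ++ bs') c = M.run A bs' c' := by
  simp [run_append, h]

theorem run_single (M : Machine) (A : Language Bool) (b : Bool) (c : M.Cfg) :
    M.run A [b] c = M.next A b c := by
  cases h : M.next A b c <;> simp [run, h]

end Machine

section Embedding

variable {N : ℕ} {Q : Type} [Finite Q] {start : Q} {instr : Q → Instr (Fin (N + 1)) Q}

theorem next_of_move (A : Language Bool) (b : Bool) (q : Q) (s : ℕ → List Bool)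
    (δ : (ℕ → Option Bool) → Bool → Q × (ℕ → StackOp))
    (h : instr q = .move (fun tops b => ((δ (extendTops tops) b).1,
      fun k => (δ (extendTops tops) b).2 k))) (s' : ℕ → List Bool) (q' : Q)
    (tops : ℕ → Option Bool)
    (htops : tops = fun k => if k < N + 1 then (s k).head? else none)
    (hq : (δ tops b).1 = q')
    (hs : ∀ k, k < N + 1 → ((δ tops b).2 k).apply (s k) = s' k) :
    (stackMachine N Q start instr).next A b ⟨q, fun k => s k⟩
      = some ⟨q', fun k => s' k⟩ := by
  have e : extendTops (fun k : Fin (N + 1) => (s k).head?) = tops := by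
    rw [htops]
    funext k
    simp [extendTops]
  simp only [Machine.next, h, Option.some.injEq, Machine.Cfg.mk.injEq]
  rw [e]
  exact ⟨hq, funext fun k => hs k k.2⟩

/-- Correctness of compilation. Embedded instructions ignore the choice bit, so every choice
sequence of length t leads to the same configuration; the bound on the registers ensures that each
test reads a stack the machine really has. -/
theorem run_of_exec (A : Language Bool) {p s s' t} (h : Exec p s s' t) :
    ∀ (e : p.Pos → Q) (x : Q), Embeds instr p e x → p.bound ≤ N + 1 →
      ∀ bs : List Bool, bs.length = t →
      (stackMachine N Q start instr).run A bs ⟨e p.entry, fun k => s k⟩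
        = some ⟨x, fun k => s' k⟩ := by
  induction h with
  | op r o s =>
    intro e x he hN bs hbs
    obtain ⟨b, rfl⟩ := List.length_eq_one_iff.1 hbs
    rw [Machine.run_single]
    refine next_of_move A b _ s (fun tops _ => Prog.step (.op r o) e x () tops) (he ()) _ _ _ rfl
      rfl ?_
    intro k _
    by_cases hk : k = r
    · subst hk; simp [Prog.step]
    · simp [Prog.step, hk, StackOp.apply]
  | @seq p q s s' s'' t t' _ _ ih₁ ih₂ =>
    intro e x he hN bs hbs
    simp only [Prog.bound, max_le_iff] at hN
    rw [← List.take_append_drop t bs]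
    have h₁ := ih₁ (fun z => e (Sum.inl z)) (e (Sum.inr q.entry)) (fun y => he (Sum.inl y)) hN.1
      (bs.take t) (by simp; omega)
    refine (Machine.run_append_of_eq h₁).trans ?_
    exact ih₂ (fun z => e (Sum.inr z)) x (fun y => he (Sum.inr y)) hN.2 _ (by simp; omega)
  | @case r br s s' t _ ih =>
    intro e x he hN bs hbs
    simp only [Prog.bound, max_le_iff] at hN
    obtain ⟨b, bs, rfl⟩ := List.exists_cons_of_length_eq_add_one hbs
    have h₁ := next_of_move (start := start) A b _ s
      (fun tops _ => Prog.step (.case r br) e x none tops) (he none) s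
      (e (some ⟨(s r).head?, (br (s r).head?).entry⟩ : Option _)) _ rfl
      (by simp only [Prog.step]; rw [if_pos (by omega)])
      (by intro k _; simp [Prog.step, StackOp.apply])
    rw [← Machine.run_single] at h₁
    refine (Machine.run_append_of_eq (bs := [b]) h₁).trans ?_
    refine ih (fun z => e (some ⟨_, z⟩ : Option _)) x (fun y => he (some ⟨_, y⟩)) ?_ bs
      (by simpa using hbs)
    rcases (s r).head? with _ | _ | _ <;> tauto
  | @loop_end r c p s hc =>
    intro e x he hN bs hbs
    simp only [Prog.bound, max_le_iff] at hN
    obtain ⟨b, rfl⟩ := List.length_eq_one_iff.1 hbs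
    rw [Machine.run_single]
    refine next_of_move A b _ s (fun tops _ => Prog.step (.loop r c p) e x none tops) (he none)
      _ _ _ rfl ?_ ?_
    · refine if_neg ?_
      beta_reduce
      rw [if_pos (by omega : r < N + 1), hc]
      exact Bool.false_ne_true
    · intro k _; simp [Prog.step, StackOp.apply]
  | @loop_continue r c p s s' s'' t t' hc _ _ ih₁ ih₂ =>
    intro e x he hN bs hbs
    have hN' := hN
    simp only [Prog.bound, max_le_iff] at hN
    obtain ⟨b, bs, rfl⟩ := List.exists_cons_of_length_eq_add_one hbs
    have h₁ := next_of_move (start := start) A b _ s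
      (fun tops _ => Prog.step (.loop r c p) e x none tops) (he none) s
      (e (some p.entry : Option _)) _ rfl
      (if_pos (by beta_reduce; rw [if_pos (by omega : r < N + 1), hc]))
      (by intro k _; simp [Prog.step, StackOp.apply])
    rw [← Machine.run_single] at h₁
    refine (Machine.run_append_of_eq (bs := [b]) h₁).trans ?_
    rw [← List.take_append_drop t bs]
    simp only [List.length_cons] at hbs
    have h₂ := ih₁ (fun z => e (some z : Option _)) (e (none : Option _))
      (fun y => he (some y)) hN.2 (bs.take t) (by simp; omega)
    refine (Machine.run_append_of_eq h₂).trans ?_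
    exact ih₂ e x he hN' _ (by simp; omega)

end Embedding

/-! ### Basic programs -/

namespace Prog

/-- The program that does nothing. -/
def skip : Prog := op 0 .keep

/-- Empty register `a`, executing `body b` for each letter `b` that is removed. -/
def drain (a : ℕ) (body : Bool → Prog) : Prog :=
  loop a Option.isSome (case a fun o =>
    match o with
    | none => skip
    | some b => seq (op a .pop) (body b))

/-- Empty register `a`. -/
def clear (a : ℕ) : Prog := drain a fun _ => skip

/-- Move the content of register `a`, in reverse order, onto register `d`. -/
def move (a d : ℕ) : Prog := drain a fun b => op d (.push b)

/-- Move the content of register `a`, in reverse order, onto the registers `d` and `e`. -/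
def copy (a d e : ℕ) : Prog := drain a fun b => seq (op d (.push b)) (op e (.push b))

/-- Move the content of register `a`, in reverse order and each letter preceded by `1`,
onto register `d`. -/
def mark (a d : ℕ) : Prog := drain a fun b => seq (op d (.push b)) (op d (.push true))

/-- Push a word onto register `a`. -/
def pushWord (a : ℕ) : List Bool → Prog
  | [] => op a .keep
  | b :: l => seq (pushWord a l) (op a (.push b))

/-- Split register `0`: the reversed first component is moved onto register `d`,
the second one stays in register `0`. -/
def split (d : ℕ) : Prog :=
  seq (loop 0 (fun o => o == some true) (seq (op 0 .pop) (case 0 fun o =>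
    match o with
    | none => skip
    | some b => seq (op 0 .pop) (op d (.push b))))) (op 0 .pop)

end Prog

open Prog

theorem update_eq_of_eq {s : ℕ → List Bool} {r : ℕ} {l : List Bool} (h : s r = l) :
    update s r l = s := by rw [← h, update_eq_self]

theorem exec_skip (s : ℕ → List Bool) : Exec skip s s 1 :=
  (Exec.op 0 .keep s).cast (by simp [StackOp.apply]) rfl

/-- The hypothesis `hcomm` expresses that the body neither depends on nor alters the drained
register. Besides the body, each letter costs three steps: loop test, case distinction and pop. -/
theorem exec_drain {a c : ℕ} {body : Bool → Prog} {F : Bool → (ℕ → List Bool) → ℕ → List Bool}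
    (hF : ∀ b s, ∃ t ≤ c, Exec (body b) s (F b s) t)
    (hcomm : ∀ b s v, F b (update s a v) = update (F b s) a v) (l : List Bool) :
    ∀ s : ℕ → List Bool, s a = l → ∃ t ≤ (c + 3) * l.length + 1,
      Exec (drain a body) s (l.foldl (fun s b => F b s) (update s a [])) t := by
  induction l with
  | nil =>
    intro s hs
    refine ⟨1, by simp, (Exec.loop_end (by simp [hs])).cast ?_ rfl⟩
    simp only [List.foldl_nil]
    rw [← hs, update_eq_self]
  | cons b l ih =>
    intro s hs
    obtain ⟨t, ht, h⟩ := hF b (update s a l)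
    rw [hcomm] at h
    obtain ⟨t', ht', h'⟩ := ih (update (F b s) a l) (by simp)
    have h₁ : Exec (.seq (.op a .pop) (body b)) s (update (F b s) a l) (1 + t) :=
      Exec.seq ((Exec.op a .pop s).cast (by simp [StackOp.apply, hs]) rfl) h
    refine ⟨1 + t + 1 + t' + 1, ?_, Exec.loop_continue (by simp [hs])
      (Exec.case (s := s) (by simpa [hs] using h₁)) (h'.cast ?_ rfl)⟩
    · simp only [List.length_cons]
      linarith
    · simp [hcomm]

theorem exec_clear {a : ℕ} {s s' : ℕ → List Bool} (h : s' = update s a []) :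
    ∃ t ≤ 4 * (s a).length + 1, Exec (clear a) s s' t := by
  subst h
  obtain ⟨t, ht, h⟩ := exec_drain (a := a) (F := fun _ s => s)
    (fun _ s => ⟨1, le_rfl, exec_skip s⟩) (fun _ _ _ => rfl) (s a) s rfl
  exact ⟨t, ht, h.cast (by simp) rfl⟩

theorem exec_move {a d : ℕ} (had : a ≠ d) {s s' : ℕ → List Bool}
    (h : s' = update (update s a []) d ((s a).reverse ++ s d)) :
    ∃ t ≤ 4 * (s a).length + 1, Exec (move a d) s s' t := by
  subst h
  obtain ⟨t, ht, h⟩ := exec_drain (a := a) (F := fun b s => update s d (b :: s d))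
    (fun b s => ⟨1, le_rfl, Exec.op d (.push b) s⟩)
    (fun b s v => by simp [had.symm, update_comm had]) (s a) s rfl
  refine ⟨t, ht, h.cast ?_ rfl⟩
  have key : ∀ (l : List Bool) (s : ℕ → List Bool),
      l.foldl (fun s b => update s d (b :: s d)) s = update s d (l.reverse ++ s d) := by
    intro l
    induction l with
    | nil => simp
    | cons b l ih => intro s; simp [ih]
  rw [key]
  simp [had.symm]

theorem exec_mark {a d : ℕ} (had : a ≠ d) {s s' : ℕ → List Bool}
    (h : s' = update (update s a []) d ((s a).reverse.flatMap (fun b => [true, b]) ++ s d)) :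
    ∃ t ≤ 5 * (s a).length + 1, Exec (mark a d) s s' t := by
  subst h
  obtain ⟨t, ht, h⟩ := exec_drain (a := a) (F := fun b s => update s d (true :: b :: s d))
    (fun b s => ⟨2, le_rfl, ((Exec.op d (.push b) s).seq (Exec.op d (.push true) _)).cast
      (by simp [StackOp.apply]) rfl⟩)
    (fun b s v => by simp [had.symm, update_comm had]) (s a) s rfl
  refine ⟨t, ht, h.cast ?_ rfl⟩
  have key : ∀ (l : List Bool) (s : ℕ → List Bool),
      l.foldl (fun s b => update s d (true :: b :: s d)) s
        = update s d (l.reverse.flatMap (fun b => [true, b]) ++ s d) := by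
    intro l
    induction l with
    | nil => simp
    | cons b l ih => intro s; simp [ih]
  rw [key]
  simp [had.symm]

theorem exec_copy {a d e : ℕ} (had : a ≠ d) (hae : a ≠ e) (hde : d ≠ e) {s s' : ℕ → List Bool}
    (h : s' = update (update (update s a []) d ((s a).reverse ++ s d)) e
      ((s a).reverse ++ s e)) :
    ∃ t ≤ 5 * (s a).length + 1, Exec (copy a d e) s s' t := by
  subst h
  obtain ⟨t, ht, h⟩ := exec_drain (a := a)
    (F := fun b s => update (update s d (b :: s d)) e (b :: s e))
    (fun b s => ⟨2, le_rfl, ((Exec.op d (.push b) s).seq (Exec.op e (.push b) _)).cast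
      (by simp [StackOp.apply, hde.symm]) rfl⟩)
    (fun b s v => by simp [had.symm, hae.symm, update_comm had, update_comm hae]) (s a) s rfl
  refine ⟨t, ht, h.cast ?_ rfl⟩
  have key : ∀ (l : List Bool) (s : ℕ → List Bool),
      l.foldl (fun s b => update (update s d (b :: s d)) e (b :: s e)) s
        = update (update s d (l.reverse ++ s d)) e (l.reverse ++ s e) := by
    intro l
    induction l with
    | nil => simp
    | cons b l ih =>
      intro s
      simp only [List.foldl_cons, ih]
      funext i
      by_cases h₁ : i = e
      · subst h₁; simp
      · by_cases h₂ : i = d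
        · subst h₂; simp [h₁]
        · simp [h₁, h₂]
  rw [key]
  simp [had.symm, hae.symm]

theorem exec_pushWord (a : ℕ) (l : List Bool) {s s' : ℕ → List Bool}
    (h : s' = update s a (l ++ s a)) : Exec (pushWord a l) s s' (l.length + 1) := by
  subst h
  induction l with
  | nil => exact Exec.op a .keep s
  | cons b l ih =>
    exact (ih.seq (Exec.op a (.push b) _)).cast (by simp [StackOp.apply]) (by simp)

/-! ### Pairing of words. -/

/-- The code of a pair of words. -/
def pair (x y : List Bool) : List Bool := encodeWord x ++ y

/-- The components of a pair (and arbitrary values if the word is not the code of a pair). -/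
def unpair : List Bool → List Bool × List Bool
  | true :: b :: z => (b :: (unpair z).1, (unpair z).2)
  | [true] => ([], [])
  | [] => ([], [])
  | false :: z => ([], z)

@[simp] theorem unpair_pair (x y : List Bool) : unpair (pair x y) = (x, y) := by
  induction x with
  | nil => simp [pair, encodeWord, unpair]
  | cons b x ih =>
    have : pair (b :: x) y = true :: b :: pair x y := by simp [pair, encodeWord]
    rw [this, unpair, ih]

theorem length_encodeWord (x : List Bool) : (encodeWord x).length = 2 * x.length + 1 := by
  simp [encodeWord, mul_comm]

@[simp] theorem length_pair (x y : List Bool) :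
    (pair x y).length = 2 * x.length + 1 + y.length := by
  simp [pair, length_encodeWord]

theorem length_unpair_le (z : List Bool) :
    (unpair z).1.length + (unpair z).2.length ≤ z.length := by
  induction z using unpair.induct <;> simp_all [unpair]; omega

theorem exec_split {d : ℕ} (hd : d ≠ 0) {s s' : ℕ → List Bool}
    (h : s' = update (update s 0 (unpair (s 0)).2) d ((unpair (s 0)).1.reverse ++ s d)) :
    ∃ t ≤ 6 * (s 0).length + 3, Exec (split d) s s' t := by
  -- The loop stops in front of the end marker, so what it leaves in register 0 is a word whose tail
  -- is the second component; the pop after the loop removes the marker.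
  have key : ∀ (z : List Bool) (s : ℕ → List Bool), s 0 = z → ∃ t ≤ 6 * z.length + 1, ∃ z',
      z'.tail = (unpair z).2 ∧ Exec (loop 0 (fun o => o == some true) (seq (op 0 .pop)
        (case 0 fun o => match o with
          | none => skip
          | some b => seq (op 0 .pop) (op d (.push b))))) s
        (update (update s 0 z') d ((unpair z).1.reverse ++ s d)) t := by
    intro z
    induction z using unpair.induct with
    | case1 b z ih =>
      intro s hs
      obtain ⟨t, ht, z', hz', h⟩ := ih (update (update s 0 z) d (b :: s d)) (by simp [hd.symm])
      refine ⟨1 + (2 + 1) + t + 1, by simp; omega, z', by simpa [unpair] using hz',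
        Exec.loop_continue (by simp [hs]) (Exec.seq (Exec.op 0 .pop s)
          (Exec.case (s' := update (update s 0 z) d (b :: s d)) ?_)) (h.cast ?_ rfl)⟩
      · simp only [update_self, hs, StackOp.apply, List.tail_cons, List.head?_cons]
        exact ((Exec.op 0 .pop _).seq (Exec.op d (.push b) _)).cast
          (by simp [StackOp.apply, hd]) rfl
      · funext i
        by_cases h₁ : i = d
        · subst h₁; simp [unpair]
        · by_cases h₂ : i = 0
          · subst h₂; simp [hd.symm]
          · simp [h₁, h₂]
    | case2 =>
      intro s hs
      refine ⟨1 + (1 + 1) + 1 + 1, by simp, [], by simp [unpair],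
        Exec.loop_continue (by simp [hs]) (Exec.seq (Exec.op 0 .pop s)
          (Exec.case (s' := update s 0 []) ?_)) ((Exec.loop_end ?_).cast ?_ rfl)⟩
      · simp only [update_self, hs, StackOp.apply, List.tail_cons, List.head?_nil]
        exact exec_skip _
      · simp
      · simp [unpair, hd]
    | case3 =>
      intro s hs
      exact ⟨1, by simp, [], by simp [unpair], (Exec.loop_end (by simp [hs])).cast
        (by simp [unpair, update_eq_of_eq hs]) rfl⟩
    | case4 z =>
      intro s hs
      exact ⟨1, by simp, false :: z, by simp [unpair], (Exec.loop_end (by simp [hs])).cast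
        (by simp [unpair, update_eq_of_eq hs]) rfl⟩
  subst h
  obtain ⟨t, ht, z', hz', h⟩ := key (s 0) s rfl
  refine ⟨t + 1, by omega, h.seq ((Exec.op 0 .pop _).cast ?_ rfl)⟩
  funext i
  by_cases h₁ : i = d
  · subst h₁; simp [hd]
  · by_cases h₂ : i = 0
    · subst h₂; simp [hd.symm, StackOp.apply, hz']
    · simp [h₁, h₂]

/-! ### Functions computed by programs -/

section Comp

variable {α : Type*} {e f g h : α → List Bool} {T T' : α → ℕ}

/-- The program `p` replaces `e a` by `f a` in register `0` in time `T a`, using the registers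
below `N`. -/
def Computes (p : Prog) (N : ℕ) (e f : α → List Bool) (T : α → ℕ) : Prop :=
  ∀ (a : α) (s : ℕ → List Bool), s 0 = e a → (∀ i, 0 < i → i < N → s i = []) →
    ∃ t ≤ T a, Exec p s (update s 0 (f a)) t

/-- Some program replaces `e a` by `f a` in time `T a`. -/
def Comp (e f : α → List Bool) (T : α → ℕ) : Prop :=
  ∃ p N, Computes p N e f T

theorem Computes.mono {p N N'} (h : Computes p N e f T) (hN : N ≤ N')
    (hT : ∀ a, T a ≤ T' a) : Computes p N' e f T' := fun a s h₀ hs => by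
  obtain ⟨t, ht, h⟩ := h a s h₀ fun i h₁ h₂ => hs i h₁ (by omega)
  exact ⟨t, ht.trans (hT _), h⟩

theorem Computes.exec {p N} (h : Computes p N e f T) (a : α) {s s' : ℕ → List Bool}
    (hs : ∀ i, 0 < i → i < N → s i = []) (h₀ : s 0 = e a) (hs' : s' = update s 0 (f a)) :
    ∃ t ≤ T a, Exec p s s' t := hs' ▸ h a s h₀ hs

theorem Comp.mono (h : Comp e f T) (hT : ∀ a, T a ≤ T' a) : Comp e f T' := by
  obtain ⟨p, N, h⟩ := h
  exact ⟨p, N, h.mono le_rfl hT⟩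

theorem Comp.precomp {β : Type*} (h : Comp e f T) (u : β → α) :
    Comp (fun b => e (u b)) (fun b => f (u b)) (fun b => T (u b)) := by
  obtain ⟨p, N, h⟩ := h
  exact ⟨p, N, fun b => h (u b)⟩

theorem Comp.length_le (h : Comp e f T) (a : α) : (f a).length ≤ (e a).length + T a := by
  obtain ⟨p, N, h⟩ := h
  obtain ⟨t, ht, h⟩ := h a (fun i => if i = 0 then e a else []) (by simp)
    (by intro i hi; simp [hi.ne'])
  have := h.length_le 0
  simp only [if_true, update_self] at this
  omega

theorem Comp.comp (hg : Comp f g T') (hf : Comp e f T) : Comp e g (fun a => T a + T' a) := by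
  obtain ⟨p, N, hf⟩ := hf
  obtain ⟨q, N', hg⟩ := hg
  refine ⟨.seq p q, max N N', fun a s h₀ hs => ?_⟩
  obtain ⟨t, ht, h⟩ := (hf.mono (le_max_left N N') fun _ => le_rfl) a s h₀ hs
  obtain ⟨t', ht', h'⟩ := (hg.mono (le_max_right N N') fun _ => le_rfl) a
    (update s 0 (f a)) (by simp) (by intro i h₁ h₂; simp [h₁.ne', hs i h₁ h₂])
  refine ⟨t + t', add_le_add ht ht', h.seq (h'.cast (by simp) rfl)⟩

/-- The input is needed twice, so a copy waits in a register above the scratch space of both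
programs while the first one runs. Moving a register reverses it, hence each word is moved an even
number of times in total. -/
theorem Comp.pair (hf : Comp e f T) (hg : Comp e g T') :
    Comp e (fun a => pair (f a) (g a))
      (fun a => 20 * (e a).length + 20 * (f a).length + 20 + T a + T' a) := by
  obtain ⟨p, N, hf⟩ := hf
  obtain ⟨q, N', hg⟩ := hg
  obtain ⟨n, hn, hn₁, hn₂⟩ : ∃ n, 0 < n ∧ N ≤ n ∧ N' ≤ n := ⟨max N N' + 1, by omega⟩
  replace hf := hf.mono hn₁ fun _ => le_rfl
  replace hg := hg.mono hn₂ fun _ => le_rfl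
  refine ⟨.seq (move 0 n) (.seq (copy n 0 (n + 1)) (.seq p (.seq (move 0 n)
    (.seq (move (n + 1) (n + 2)) (.seq (move (n + 2) 0) (.seq q (.seq (.op 0 (.push false))
    (mark n 0)))))))), n + 3, fun a s hx hs => ?_⟩
  let st : List Bool → List Bool → List Bool → List Bool → ℕ → List Bool := fun a b c d i =>
    if i = 0 then a else if i = n then b else if i = n + 1 then c else if i = n + 2 then d else s i
  have h0 : ∀ a b c d, st a b c d 0 = a := fun a b c d => by simp [st]
  have hn0 : ∀ a b c d, st a b c d n = b := fun a b c d => by simp [st, hn.ne']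
  have hn1 : ∀ a b c d, st a b c d (n + 1) = c := fun a b c d => by simp [st]
  have hn2 : ∀ a b c d, st a b c d (n + 2) = d := fun a b c d => by simp [st]
  have hst : ∀ a b c d i, 0 < i → i < n → st a b c d i = [] := by
    intro a b c d i h₁ h₂
    simp only [st, h₁.ne', h₂.ne, (show i ≠ n + 1 by omega), (show i ≠ n + 2 by omega), if_false]
    exact hs i h₁ (by omega)
  have u0 : ∀ a b c d v, update (st a b c d) 0 v = st v b c d := by
    intros; funext i; by_cases h : i = 0 <;> simp [st, h]
  have un0 : ∀ a b c d v, update (st a b c d) n v = st a v c d := by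
    intros; funext i; by_cases h : i = n <;> simp [st, h, hn.ne']
  have un1 : ∀ a b c d v, update (st a b c d) (n + 1) v = st a b v d := by
    intros; funext i; by_cases h : i = n + 1 <;> simp [st, h]
  have un2 : ∀ a b c d v, update (st a b c d) (n + 2) v = st a b c v := by
    intros; funext i; by_cases h : i = n + 2 <;> simp [st, h]
  obtain ⟨x, hxe⟩ : ∃ x, x = e a := ⟨_, rfl⟩
  have hs0 : s = st x [] [] [] := by
    funext i
    simp only [st]
    split_ifs with h₁ h₂ h₃ h₄
    · rw [hxe, h₁, hx]
    · rw [h₂, hs n hn (by omega)]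
    · rw [h₃, hs _ (by omega) (by omega)]
    · rw [h₄, hs _ (by omega) (by omega)]
    · rfl
  have e₀ : update s 0 (WeakEXP.pair (f a) (g a)) = st (WeakEXP.pair (f a) (g a)) [] [] [] := by
    rw [hs0, u0]
  rw [e₀, hs0]
  obtain ⟨t₁, ht₁, h₁⟩ := exec_move (a := 0) (d := n) hn.ne (s := st x [] [] [])
    (s' := st [] x.reverse [] []) (by simp [h0, hn0, u0, un0])
  obtain ⟨t₂, ht₂, h₂⟩ := exec_copy (a := n) (d := 0) (e := n + 1) hn.ne' (by omega) (by omega)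
    (s := st [] x.reverse [] []) (s' := st x [] x [])
    (by simp [h0, hn0, u0, un0, un1, hn1])
  obtain ⟨t₃, ht₃, h₃⟩ := hf.exec a (s := st x [] x []) (s' := st (f a) [] x [])
    (hst _ _ _ _) (by rw [h0, hxe]) (by simp [u0])
  obtain ⟨t₄, ht₄, h₄⟩ := exec_move (a := 0) (d := n) hn.ne (s := st (f a) [] x [])
    (s' := st [] (f a).reverse x []) (by simp [h0, hn0, u0, un0])
  obtain ⟨t₅, ht₅, h₅⟩ := exec_move (a := n + 1) (d := n + 2) (by omega)
    (s := st [] (f a).reverse x []) (s' := st [] (f a).reverse [] x.reverse)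
    (by simp [hn1, hn2, un1, un2])
  obtain ⟨t₆, ht₆, h₆⟩ := exec_move (a := n + 2) (d := 0) (by omega)
    (s := st [] (f a).reverse [] x.reverse) (s' := st x (f a).reverse [] [])
    (by simp [h0, hn2, u0, un2])
  obtain ⟨t₇, ht₇, h₇⟩ := hg.exec a (s := st x (f a).reverse [] [])
    (s' := st (g a) (f a).reverse [] []) (hst _ _ _ _) (by rw [h0, hxe]) (by simp [u0])
  have h₈ : Exec (.op 0 (.push false)) (st (g a) (f a).reverse [] [])
      (st (false :: g a) (f a).reverse [] []) 1 :=
    (Exec.op _ _ _).cast (by simp [StackOp.apply, h0, u0]) rfl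
  obtain ⟨t₉, ht₉, h₉⟩ := exec_mark (a := n) (d := 0) (by omega)
    (s := st (false :: g a) (f a).reverse [] []) (s' := st (WeakEXP.pair (f a) (g a)) [] [] [])
    (by simp [h0, hn0, u0, un0, WeakEXP.pair, encodeWord])
  simp only [h0, hn0, hn1, hn2, List.length_reverse, hxe] at *
  exact ⟨_, by omega, h₁.seq (h₂.seq (h₃.seq (h₄.seq (h₅.seq (h₆.seq (h₇.seq (h₈.seq h₉)))))))⟩

theorem Comp.id (e : α → List Bool) : Comp e e (fun _ => 1) :=
  ⟨skip, 0, fun _ s hs _ => ⟨1, le_rfl, (exec_skip s).cast (update_eq_of_eq hs).symm rfl⟩⟩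

theorem Comp.cons (e : α → List Bool) (b : Bool) : Comp e (fun a => b :: e a) (fun _ => 1) :=
  ⟨.op 0 (.push b), 0, fun _ s hs _ => ⟨1, le_rfl,
    (Exec.op 0 (.push b) s).cast (by simp [StackOp.apply, hs]) rfl⟩⟩

theorem Comp.tail (e : α → List Bool) : Comp e (fun a => (e a).tail) (fun _ => 1) :=
  ⟨.op 0 .pop, 0, fun _ s hs _ => ⟨1, le_rfl,
    (Exec.op 0 .pop s).cast (by simp [StackOp.apply, hs]) rfl⟩⟩

theorem Comp.const (e : α → List Bool) (l : List Bool) :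
    Comp e (fun _ => l) (fun a => 4 * (e a).length + l.length + 2) := by
  refine ⟨.seq (clear 0) (pushWord 0 l), 0, fun a s hs _ => ?_⟩
  obtain ⟨t, ht, h⟩ := exec_clear (a := 0) (s := s) rfl
  exact ⟨_, by dsimp only; rw [hs] at ht; omega, h.seq (exec_pushWord 0 l (by simp))⟩

theorem Comp.cond {c : α → Bool} (hf : Comp e f T) (hg : Comp e g T') :
    Comp (fun a => c a :: e a) (fun a => if c a then f a else g a)
      (fun a => T a + T' a + 2) := by
  obtain ⟨p, N, hf⟩ := hf
  obtain ⟨q, N', hg⟩ := hg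
  refine ⟨.case 0 fun o => match o with
    | none => skip
    | some true => .seq (.op 0 .pop) p
    | some false => .seq (.op 0 .pop) q, max N N', fun a s h₀ hs => ?_⟩
  have hpop : Exec (.op 0 .pop) s (update s 0 (e a)) 1 :=
    (Exec.op _ _ _).cast (by simp [StackOp.apply, h₀]) rfl
  have hcl : ∀ i, 0 < i → i < max N N' → update s 0 (e a) i = [] := by
    intro i h₁ h₂; simp [h₁.ne', hs i h₁ h₂]
  cases hc : c a
  · obtain ⟨t, ht, h⟩ := (hg.mono (le_max_right N N') fun _ => le_rfl).exec a hcl (by simp) rfl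
    refine ⟨1 + t + 1, by dsimp only; omega, Exec.case ?_⟩
    simpa [h₀, hc] using hpop.seq h
  · obtain ⟨t, ht, h⟩ := (hf.mono (le_max_left N N') fun _ => le_rfl).exec a hcl (by simp) rfl
    refine ⟨1 + t + 1, by dsimp only; omega, Exec.case ?_⟩
    simpa [h₀, hc] using hpop.seq h

theorem Comp.headMap (e : α → List Bool) (φ : Option Bool → List Bool) :
    ∃ c, Comp e (fun a => φ (e a).head?) (fun a => 4 * (e a).length + c) := by
  refine ⟨(φ none).length + (φ (some true)).length + (φ (some false)).length + 3,
    .case 0 fun o => .seq (clear 0) (pushWord 0 (φ o)), 0, fun a s h₀ hs => ?_⟩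
  beta_reduce
  rw [← h₀]
  obtain ⟨t, ht, h'⟩ := exec_clear (a := 0) (s := s) rfl
  refine ⟨t + ((φ (s 0).head?).length + 1) + 1, ?_,
    Exec.case (h'.seq (exec_pushWord 0 _ (by simp)))⟩
  rcases (s 0).head? with _ | _ | _ <;> omega

theorem Comp.fst (e : α → List Bool) :
    Comp e (fun a => (unpair (e a)).1) (fun a => 20 * (e a).length + 10) := by
  refine ⟨.seq (split 1) (.seq (clear 0) (move 1 0)), 2, fun a s h₀ hs => ?_⟩
  have hs1 : s 1 = [] := hs 1 one_pos one_lt_two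
  obtain ⟨t₁, ht₁, h₁⟩ := exec_split (d := 1) one_ne_zero (s := s) rfl
  obtain ⟨t₂, ht₂, h₂⟩ := exec_clear (a := 0) (s := update (update s 0 (unpair (s 0)).2) 1
    ((unpair (s 0)).1.reverse ++ s 1)) rfl
  obtain ⟨t₃, ht₃, h₃⟩ := exec_move (a := 1) (d := 0) one_ne_zero
    (s := update (update (update s 0 (unpair (s 0)).2) 1 ((unpair (s 0)).1.reverse ++ s 1)) 0 [])
    rfl
  have := length_unpair_le (s 0)
  simp [hs1] at ht₁ ht₂ ht₃
  beta_reduce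
  rw [← h₀]
  refine ⟨t₁ + (t₂ + t₃), by omega, h₁.seq (h₂.seq (h₃.cast ?_ rfl))⟩
  funext i
  by_cases h0 : i = 0
  · subst h0; simp [hs1]
  · by_cases h1 : i = 1
    · subst h1; simp [hs1]
    · simp [h0, h1]

theorem Comp.snd (e : α → List Bool) :
    Comp e (fun a => (unpair (e a)).2) (fun a => 20 * (e a).length + 10) := by
  refine ⟨.seq (split 1) (clear 1), 2, fun a s h₀ hs => ?_⟩
  have hs1 : s 1 = [] := hs 1 one_pos one_lt_two
  obtain ⟨t₁, ht₁, h₁⟩ := exec_split (d := 1) one_ne_zero (s := s) rfl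
  obtain ⟨t₂, ht₂, h₂⟩ := exec_clear (a := 1) (s := update (update s 0 (unpair (s 0)).2) 1
    ((unpair (s 0)).1.reverse ++ s 1)) rfl
  have := length_unpair_le (s 0)
  simp [hs1] at ht₁ ht₂
  beta_reduce
  rw [← h₀]
  refine ⟨t₁ + t₂, by omega, h₁.seq (h₂.cast ?_ rfl)⟩
  funext i
  by_cases h1 : i = 1
  · subst h1; simp [hs1]
  · simp [h1]

/-- The first component is a unary counter, kept in a register beyond the scratch space of the
iterated program. Splitting reverses it, which is harmless as only its length matters. -/
theorem Comp.iterate {k : α → α} (hf : Comp e (fun a => e (k a)) T) (B : List Bool × α → ℕ)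
    (hB : ∀ z : List Bool × α, ∀ i < z.1.length, T (k^[i] z.2) ≤ B z) :
    Comp (fun z : List Bool × α => WeakEXP.pair z.1 (e z.2)) (fun z => e (k^[z.1.length] z.2))
      (fun z => 12 * z.1.length + 6 * (e z.2).length + 10 + z.1.length * (B z + 2)) := by
  obtain ⟨p, N, hf⟩ := hf
  obtain ⟨n, hn, hNn⟩ : ∃ n, 0 < n ∧ N ≤ n := ⟨N + 1, by omega⟩
  replace hf := hf.mono hNn fun _ => le_rfl
  refine ⟨.seq (split n) (.loop n Option.isSome (.seq (.op n .pop) p)), n + 1,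
    fun ⟨w, a⟩ s h₀ hs => ?_⟩
  obtain ⟨t, ht, h⟩ := exec_split (d := n) hn.ne' (s := s) rfl
  have key : ∀ (l : List Bool) (y : α) (b : ℕ), (∀ i < l.length, T (k^[i] y) ≤ b) →
      ∃ t ≤ 1 + l.length * (b + 2),
      Exec (.loop n Option.isSome (.seq (.op n .pop) p)) (update (update s 0 (e y)) n l)
        (update s 0 (e (k^[l.length] y))) t := by
    intro l
    induction l with
    | nil =>
      intro y b _
      refine ⟨1, by simp, (Exec.loop_end (by simp)).cast ?_ rfl⟩
      have : update s 0 (e y) n = [] := by simp [hn.ne', hs n hn (by omega)]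
      simp [update_eq_of_eq this]
    | cons c l ih =>
      intro y b hb
      obtain ⟨t₁, ht₁, h₁⟩ := hf.exec y (s := update (update s 0 (e y)) n l)
        (s' := update (update s 0 (e (k y))) n l)
        (by intro i h₁ h₂; simp [h₁.ne', h₂.ne, hs i h₁ (by omega)]) (by simp [hn.ne])
        (by simp [update_comm hn.ne'])
      obtain ⟨t₂, ht₂, h₂⟩ := ih (k y) b fun i hi => by
        simpa using hb (i + 1) (by simpa using hi)
      have hb0 := hb 0 (by simp)
      simp only [iterate_zero, id_eq] at hb0
      refine ⟨1 + t₁ + t₂ + 1, ?_, Exec.loop_continue (by simp)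
        (Exec.seq ((Exec.op n .pop _).cast (by simp [StackOp.apply]) rfl) h₁) h₂⟩
      simp only [List.length_cons, add_mul, one_mul]
      omega
  obtain ⟨t', ht', h'⟩ := key w.reverse a (B (w, a)) (by simpa using hB (w, a))
  simp only [List.length_reverse] at ht' h'
  rw [h₀] at ht
  simp only [h₀, unpair_pair, hs n hn (by omega), List.append_nil] at h
  simp only [length_pair] at ht
  exact ⟨t + t', by dsimp only; omega, h.seq h'⟩

end Comp

/-! ### Functions computable in polynomial time -/

theorem polynomial_eval_mono (p : Polynomial ℕ) {m n : ℕ} (h : m ≤ n) : p.eval m ≤ p.eval n := by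
  induction p using Polynomial.induction_on' with
  | add p q hp hq => simpa using add_le_add hp hq
  | monomial k a => simpa using Nat.mul_le_mul_left a (Nat.pow_le_pow_left h k)

/-- Some program replaces `e a` by `f a` in polynomial time. -/
def FP {α : Type*} (e f : α → List Bool) : Prop :=
  ∃ p : Polynomial ℕ, Comp e f fun a => p.eval (e a).length

namespace FP

open Polynomial

variable {α : Type*} {e f g : α → List Bool}

theorem id (e : α → List Bool) : FP e e := ⟨1, (Comp.id e).mono fun _ => by simp⟩

theorem cons (e : α → List Bool) (b : Bool) : FP e fun a => b :: e a :=
  ⟨1, (Comp.cons e b).mono fun _ => by simp⟩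

theorem tail (e : α → List Bool) : FP e fun a => (e a).tail :=
  ⟨1, (Comp.tail e).mono fun _ => by simp⟩

theorem const (e : α → List Bool) (l : List Bool) : FP e fun _ => l :=
  ⟨4 * X + C (l.length + 2), (Comp.const e l).mono fun x => by simp; omega⟩

theorem fst (e : α → List Bool) : FP e fun a => (unpair (e a)).1 :=
  ⟨20 * X + 10, (Comp.fst e).mono fun x => by simp⟩

theorem snd (e : α → List Bool) : FP e fun a => (unpair (e a)).2 :=
  ⟨20 * X + 10, (Comp.snd e).mono fun x => by simp⟩

theorem precomp {β : Type*} (h : FP e f) (u : β → α) :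
    FP (fun b => e (u b)) (fun b => f (u b)) := by
  obtain ⟨p, h⟩ := h
  exact ⟨p, h.precomp u⟩

theorem length_le (hf : FP e f) : ∃ p : ℕ[X], ∀ a, (f a).length ≤ p.eval (e a).length := by
  obtain ⟨p, hf⟩ := hf
  exact ⟨X + p, fun x => by simpa using hf.length_le x⟩

theorem comp (hg : FP f g) (hf : FP e f) : FP e g := by
  obtain ⟨r, hr⟩ := hf.length_le
  obtain ⟨p, hf⟩ := hf
  obtain ⟨q, hg⟩ := hg
  refine ⟨p + q.comp r, (hg.comp hf).mono fun x => ?_⟩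
  simpa using polynomial_eval_mono q (hr x)

theorem pair (hf : FP e f) (hg : FP e g) : FP e fun a => pair (f a) (g a) := by
  obtain ⟨r, hr⟩ := hf.length_le
  obtain ⟨p, hf⟩ := hf
  obtain ⟨q, hg⟩ := hg
  refine ⟨20 * X + 20 * r + 20 + p + q, (hf.pair hg).mono fun x => ?_⟩
  have := hr x
  simp
  omega

theorem cond {c : α → Bool} (hf : FP e f) (hg : FP e g) :
    FP (fun a => c a :: e a) fun a => if c a then f a else g a := by
  obtain ⟨p, hf⟩ := hf
  obtain ⟨q, hg⟩ := hg
  refine ⟨2 + p + q, (hf.cond hg).mono fun x => ?_⟩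
  have h₁ := polynomial_eval_mono p (show (e x).length ≤ (e x).length + 1 by simp)
  have h₂ := polynomial_eval_mono q (show (e x).length ≤ (e x).length + 1 by simp)
  simp
  omega

theorem headMap (e : α → List Bool) (φ : Option Bool → List Bool) :
    FP e fun a => φ (e a).head? := by
  obtain ⟨c, h⟩ := Comp.headMap e φ
  exact ⟨4 * X + C c, h.mono fun x => by simp⟩

theorem ite {c : α → Bool} (hc : FP e fun a => [c a]) (hf : FP e f) (hg : FP e g) :
    FP e fun a => if c a then f a else g a := by
  -- The pair code of `[c a]` and `e a` is `true :: c a :: false :: e a`; dropping its head exposes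
  -- the condition, and each branch then drops the end marker `false`.
  have h : FP e fun a => c a :: false :: e a := (tail _).comp (hc.pair (id e))
  exact ((hf.comp (tail fun a => false :: e a)).cond (hg.comp (tail fun a => false :: e a))).comp h

theorem decide_eq (l : List Bool) : FP (fun x : List Bool => x) fun x => [decide (x = l)] := by
  induction l with
  | nil =>
    convert headMap (fun x : List Bool => x) fun o => [o.isNone] using 2 with x
    cases x <;> simp
  | cons b l ih =>
    have h := (headMap (fun x : List Bool => x) fun o => [decide (o = some b)]).ite
      ((ih.precomp List.tail).comp (tail fun x : List Bool => x)) (const _ [false])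
    convert h using 2 with x
    rcases x with _ | ⟨c, x⟩
    · simp
    · by_cases hc : c = b <;> simp [hc]

/-- The length bound on all iterates cannot be derived from `hf`: iterating a polynomial-time
function, doubling for example, may produce exponentially long words. -/
theorem iterate {k : α → α} (hf : FP e (fun a => e (k a))) (p : ℕ[X])
    (hp : ∀ n a, (e (k^[n] a)).length ≤ p.eval (n + (e a).length)) :
    FP (fun z : List Bool × α => WeakEXP.pair z.1 (e z.2))
      (fun z => e (k^[z.1.length] z.2)) := by
  obtain ⟨q, hf⟩ := hf
  refine ⟨12 * X + 10 + X * (q.comp p + 2),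
    (hf.iterate (fun z => q.eval (p.eval (z.1.length + (e z.2).length))) ?_).mono fun z => ?_⟩
  · intro z i hi
    exact polynomial_eval_mono q ((hp i _).trans (polynomial_eval_mono p (by omega)))
  · simp only [eval_add, eval_mul, eval_X, eval_comp, eval_ofNat, length_pair]
    have h := polynomial_eval_mono q (polynomial_eval_mono p
      (show z.1.length + (e z.2).length ≤ 2 * z.1.length + 1 + (e z.2).length by omega))
    refine add_le_add (by omega) (Nat.mul_le_mul (by omega) (by omega))

end FP

/-! ### Polynomial time functions between encoded types -/

/-- An encoding of the elements of a type by words. -/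
class Code (α : Type) where
  /-- the code of an element -/
  enc : α → List Bool
  enc_injective : Injective enc

open Code

theorem pair_injective {x y x' y' : List Bool} (h : pair x y = pair x' y') : x = x' ∧ y = y' := by
  have := congrArg unpair h
  simpa using this

theorem encodeTuple_cons {k : ℕ} (a : List Bool) (v : Fin k → List Bool) :
    encodeTuple (Matrix.vecCons a v) = pair a (encodeTuple v) := by
  simp [encodeTuple, pair, List.ofFn_succ]

theorem encodeTuple_succ {k : ℕ} (v : Fin (k + 1) → List Bool) :
    encodeTuple v = pair (v 0) (encodeTuple fun i => v i.succ) := by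
  simp [encodeTuple, pair, List.ofFn_succ]

theorem encodeTuple_injective (k : ℕ) : Injective (encodeTuple (k := k)) := by
  induction k with
  | zero => exact injective_of_subsingleton _
  | succ k ih =>
    intro v v' h
    rw [encodeTuple_succ, encodeTuple_succ] at h
    obtain ⟨h₁, h₂⟩ := pair_injective h
    funext i
    refine Fin.cases h₁ (fun i => ?_) i
    exact congrFun (ih h₂) i

instance : Code (List Bool) := ⟨fun l => l, fun _ _ h => h⟩

instance : Code Bool := ⟨fun b => [b], fun _ _ h => by simpa using h⟩

instance : Code ℕ := ⟨fun n => List.replicate n true, fun m n h => by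
  simpa using congrArg List.length h⟩

instance {n : ℕ} : Code (Fin n) := ⟨fun i => List.replicate i true, fun i j h => by
  simpa [Fin.ext_iff] using congrArg List.length h⟩

instance {α : Type} [Code α] : Code (Option α) := ⟨fun o => match o with
  | none => []
  | some a => true :: enc a, fun o o' h => by
  rcases o with _ | a <;> rcases o' with _ | b <;> simp_all [enc_injective.eq_iff]⟩

instance {α β : Type} [Code α] [Code β] : Code (α × β) :=
  ⟨fun p => pair (enc p.1) (enc p.2), fun p q h => by
    obtain ⟨h₁, h₂⟩ := pair_injective h
    exact Prod.ext (enc_injective h₁) (enc_injective h₂)⟩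

instance {n : ℕ} {α : Type} [Code α] : Code (Fin n → α) :=
  ⟨fun v => encodeTuple fun i => enc (v i), fun v w h => by
    funext i
    exact enc_injective (congrFun (encodeTuple_injective n h) i)⟩

@[simp] theorem enc_word (l : List Bool) : enc l = l := rfl
@[simp] theorem enc_nat (n : ℕ) : enc n = List.replicate n true := rfl
@[simp] theorem enc_prod {α β : Type} [Code α] [Code β] (p : α × β) :
    enc p = pair (enc p.1) (enc p.2) := rfl

variable {α β γ δ : Type} [Code α] [Code β] [Code γ] [Code δ]

/-- The function `f` is computable in polynomial time, with respect to the codes. -/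
def Poly (f : α → β) : Prop := FP (enc : α → List Bool) fun a => enc (f a)

namespace Poly

theorem congr {f g : α → β} (hf : Poly f) (h : ∀ a, g a = f a) : Poly g := funext h ▸ hf

theorem id : Poly fun a : α => a := FP.id _

theorem const (b : β) : Poly fun _ : α => b := FP.const _ _

theorem comp {g : β → γ} {f : α → β} (hg : Poly g) (hf : Poly f) : Poly fun a => g (f a) :=
  FP.comp (FP.precomp hg f) hf

theorem pair {f : α → β} {g : α → γ} (hf : Poly f) (hg : Poly g) : Poly fun a => (f a, g a) :=
  FP.pair hf hg

theorem fst : Poly (Prod.fst : α × β → α) := by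
  have h := FP.fst (enc : α × β → List Bool)
  unfold Poly
  simpa using h

theorem snd : Poly (Prod.snd : α × β → β) := by
  have h := FP.snd (enc : α × β → List Bool)
  unfold Poly
  simpa using h

theorem comp₂ {g : β × γ → δ} {f₁ : α → β} {f₂ : α → γ} (hg : Poly g) (h₁ : Poly f₁)
    (h₂ : Poly f₂) : Poly fun a => g (f₁ a, f₂ a) := hg.comp (h₁.pair h₂)

theorem fst_comp {f : α → β × γ} (hf : Poly f) : Poly fun a => (f a).1 := fst.comp hf

theorem snd_comp {f : α → β × γ} (hf : Poly f) : Poly fun a => (f a).2 := snd.comp hf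

theorem ite {c : α → Bool} {f g : α → β} (hc : Poly c) (hf : Poly f) (hg : Poly g) :
    Poly fun a => if c a then f a else g a := by
  have h := FP.ite hc hf hg
  unfold Poly
  convert h using 2 with a
  by_cases hc : c a = true <;> simp [hc]

theorem length_le {f : α → β} (hf : Poly f) :
    ∃ p : Polynomial ℕ, ∀ a, (enc (f a)).length ≤ p.eval (enc a).length := FP.length_le hf

/-- Functions of a variable with finitely many values. -/
theorem finite_case [Finite α] {f : α → β → γ} (hf : ∀ a, Poly (f a)) :
    Poly fun p : α × β => f p.1 p.2 := by
  classical
  rcases isEmpty_or_nonempty α with hα | ⟨⟨a₀⟩⟩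
  · exact ⟨0, .op 0 .keep, 0, fun a => isEmptyElim a.1⟩
  -- Induction on the set of values that have been tested so far by comparison with their fixed
  -- codes; `a₀` serves as default for the untested ones.
  have key : ∀ S : Finset α, FP (enc : α × β → List Bool)
      fun p => if p.1 ∈ S then enc (f p.1 p.2) else enc (f a₀ p.2) := by
    intro S
    induction S using Finset.induction_on with
    | empty => exact (hf a₀).comp (snd (α := α) (β := β))
    | insert a S _ ih =>
      have h₁ : FP (enc : α × β → List Bool) fun p => [decide (enc p.1 = enc a)] :=
        ((FP.decide_eq (enc a)).precomp fun p : α × β => enc p.1).comp (fst (α := α) (β := β))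
      have h := h₁.ite ((hf a).comp (snd (α := α) (β := β))) ih
      convert h using 2 with p
      by_cases hp : p.1 = a
      · simp [hp]
      · simp [hp, enc_injective.eq_iff]
  have := Fintype.ofFinite α
  unfold Poly
  simpa using key Finset.univ

theorem finite_case_comp {α' : Type} [Code α'] [Finite α'] {f : α' → β → γ}
    {u : α → α'} {v : α → β} (hu : Poly u) (hf : ∀ a, Poly (f a)) (hv : Poly v) :
    Poly fun a => f (u a) (v a) := (finite_case hf).comp (hu.pair hv)

theorem of_finite [Finite α] (f : α → β) : Poly f :=
  (finite_case (β := α) (f := fun a _ => f a) fun a => const (f a)).comp (id.pair id)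

theorem cons : Poly fun p : Bool × List Bool => p.1 :: p.2 :=
  finite_case (f := fun b l => b :: l) fun b => FP.cons _ b

theorem tail : Poly (List.tail : List Bool → List Bool) := FP.tail _

theorem head? : Poly (List.head? : List Bool → Option Bool) := FP.headMap _ enc

theorem iterate {f : α → α} (hf : Poly f) (p : Polynomial ℕ)
    (hp : ∀ n a, (enc (f^[n] a)).length ≤ p.eval (n + (enc a).length)) :
    Poly fun z : List Bool × α => f^[z.1.length] z.2 := FP.iterate hf p hp

theorem iterate_of_length_le {f : α → α} (hf : Poly f) (c : ℕ)
    (hc : ∀ a, (enc (f a)).length ≤ (enc a).length + c) :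
    Poly fun z : List Bool × α => f^[z.1.length] z.2 := by
  refine hf.iterate (Polynomial.X * Polynomial.C (c + 1)) fun n a => ?_
  have : ∀ n, (enc (f^[n] a)).length ≤ (enc a).length + n * c := by
    intro n
    induction n with
    | zero => simp
    | succ n ih =>
      rw [iterate_succ_apply']
      have := hc (f^[n] a)
      rw [add_mul]
      omega
  refine (this n).trans ?_
  simp only [Polynomial.eval_mul, Polynomial.eval_X, Polynomial.eval_C]
  nlinarith

/-! #### Unary numbers -/

theorem replicate : Poly fun n : ℕ => List.replicate n true := FP.id _

theorem succ : Poly Nat.succ := FP.cons _ true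

theorem pred : Poly Nat.pred := by
  have h := FP.tail (enc : ℕ → List Bool)
  unfold Poly
  convert h using 2 with n
  cases n <;> simp [List.replicate_succ]

theorem iterate_nat_of_length_le {f : α → α} (hf : Poly f) (c : ℕ)
    (hc : ∀ a, (enc (f a)).length ≤ (enc a).length + c) :
    Poly fun z : ℕ × α => f^[z.1] z.2 := by
  have h := (hf.iterate_of_length_le c hc).comp₂ (replicate.comp (fst (α := ℕ) (β := α))) snd
  simpa using h

theorem length : Poly (List.length : List Bool → ℕ) := by
  have h := (succ.iterate_of_length_le 1 (by simp)).comp₂ (id (α := List Bool)) (const 0)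
  exact h.congr fun l => by simp [Nat.succ_iterate]

theorem add : Poly fun p : ℕ × ℕ => p.1 + p.2 := by
  have h := succ.iterate_nat_of_length_le 1 (by simp)
  simpa [Nat.succ_iterate, add_comm] using h

theorem sub : Poly fun p : ℕ × ℕ => p.1 - p.2 := by
  have h := (pred.iterate_nat_of_length_le 0 (by simp)).comp₂ (snd (α := ℕ) (β := ℕ)) fst
  simpa [Nat.pred_iterate] using h

theorem le : Poly fun p : ℕ × ℕ => decide (p.1 ≤ p.2) := by
  have h : Poly fun n : ℕ => decide (n = 0) := by
    have h := FP.headMap (enc : ℕ → List Bool) fun o => [o.isNone]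
    unfold Poly
    convert h using 2 with n
    cases n <;> simp [List.replicate_succ, enc]
  simpa [Nat.sub_eq_zero_iff_le] using h.comp sub

theorem mul : Poly fun p : ℕ × ℕ => p.1 * p.2 := by
  have h₁ : Poly fun p : ℕ × ℕ => (p.1, p.2 + p.1) := fst.pair (add.comp (snd.pair fst))
  have h₂ : ∀ n (p : ℕ × ℕ), (fun p : ℕ × ℕ => (p.1, p.2 + p.1))^[n] p = (p.1, p.2 + n * p.1) := by
    intro n
    induction n with
    | zero => simp
    | succ n ih => intro p; rw [iterate_succ_apply, ih]; simp; ring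
  have h₃ := h₁.iterate (Polynomial.X + Polynomial.X * Polynomial.X) (by
    intro n a
    rw [h₂]
    simp
    nlinarith)
  have h₄ := h₃.comp (pair (replicate.comp (fst (α := ℕ) (β := ℕ))) (snd.pair (const 0)))
  simpa [h₂] using h₄.snd_comp

theorem eval (p : Polynomial ℕ) : Poly fun n : ℕ => p.eval n := by
  induction p using Polynomial.induction_on' with
  | add p q hp hq => simpa using add.comp₂ hp hq
  | monomial k a =>
    simp only [Polynomial.eval_monomial]
    refine mul.comp₂ (const a) ?_
    induction k with
    | zero => simpa using const 1
    | succ k ih => simpa [pow_succ] using mul.comp₂ ih id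

/-! #### Words -/

theorem append : Poly fun p : List Bool × List Bool => p.1 ++ p.2 := by
  let f : List Bool × List Bool → List Bool × List Bool := fun p =>
    match p.1.head? with
    | none => p
    | some b => (p.1.tail, b :: p.2)
  have hf : Poly f := finite_case_comp (f := fun o (p : List Bool × List Bool) =>
    match o with
    | none => p
    | some b => (p.1.tail, b :: p.2)) (head?.comp fst) (fun o => by
      cases o with
      | none => exact id
      | some b => exact (tail.comp fst).pair (cons.comp₂ (const b) snd)) id
  have hl : ∀ a, (enc (f a)).length ≤ (enc a).length + 0 := by
    rintro ⟨_ | ⟨b, x⟩, y⟩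
    · simp [f]
    · simp [f]; omega
  have hit : ∀ x y, f^[x.length] (x, y) = ([], x.reverse ++ y) := by
    intro x
    induction x with
    | nil => simp
    | cons b x ih => intro y; simp [f, ih]
  have h := hf.iterate_of_length_le 0 hl
  -- Transferring letters one by one reverses a word; a first pass onto the empty word therefore
  -- supplies the reverse, and transferring that onto the second word restores the order.
  have h₁ : Poly fun p : List Bool × List Bool => p.1.reverse := by
    simpa [hit] using (h.comp₂ (fst (α := List Bool) (β := List Bool))
      (fst.pair (const []))).snd_comp
  have h₂ := (h.comp₂ h₁ (h₁.pair snd)).snd_comp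
  have hit' : ∀ x y : List Bool, f^[x.length] (x.reverse, y) = ([], x ++ y) := by
    intro x y
    simpa using hit x.reverse y
  simpa [hit'] using h₂

theorem eq : Poly fun p : List Bool × List Bool => decide (p.1 = p.2) := by
  let f : (List Bool × List Bool) × Bool → (List Bool × List Bool) × Bool := fun p =>
    ((p.1.1.tail, p.1.2.tail), p.2 && decide (p.1.1.head? = p.1.2.head?))
  have hf : Poly f := by
    refine pair (pair (tail.comp fst.fst_comp) (tail.comp fst.snd_comp)) ?_
    exact finite_case_comp (f := fun (o : Option Bool) (z : Option Bool × Bool) =>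
      z.2 && decide (o = z.1)) (head?.comp fst.fst_comp)
      (fun o => of_finite _) ((head?.comp fst.snd_comp).pair snd)
  have hl : ∀ a, (enc (f a)).length ≤ (enc a).length + 0 := by
    rintro ⟨⟨x, y⟩, b⟩
    simp [f, enc]
    omega
  have hit : ∀ n x y b, (f^[n] ((x, y), b)).2 = true ↔
      b = true ∧ ∀ i < n, x[i]? = y[i]? := by
    intro n
    induction n with
    | zero => simp
    | succ n ih =>
      intro x y b
      rw [iterate_succ_apply, ih, Nat.forall_lt_succ_left']
      simp [List.head?_eq_getElem?, and_assoc]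
  -- The number of rounds is one more than the length of the first word; the additional comparison
  -- detects a longer second word.
  have h := (hf.iterate_of_length_le 0 hl).comp₂
    (cons.comp₂ (const true) (fst (α := List Bool) (β := List Bool))) (id.pair (const true))
  refine h.snd_comp.congr fun p => ?_
  obtain ⟨x, y⟩ := p
  rw [Bool.eq_iff_iff, hit]
  simp only [decide_eq_true_eq, List.length_cons, true_and]
  constructor
  · rintro h i _
    rw [h]
  · intro h
    refine List.ext_getElem? fun i => ?_
    by_cases hi : i < x.length + 1
    · exact h i hi
    · have h₁ := h x.length (by omega)
      simp at h₁
      rw [List.getElem?_eq_none (by omega), List.getElem?_eq_none (by omega)]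

theorem unpair : Poly unpair := FP.pair (FP.fst _) (FP.snd _)

theorem pairWord : Poly fun p : List Bool × List Bool => WeakEXP.pair p.1 p.2 := FP.id _

theorem encode : Poly (enc : α → List Bool) := FP.id _

theorem encodeWord : Poly encodeWord := by
  have h := pairWord.comp₂ (id (α := List Bool)) (const [])
  simpa [WeakEXP.pair] using h

/-! #### Tuples -/

theorem vecCons {n : ℕ} : Poly fun p : α × (Fin n → α) =>
    (Matrix.vecCons p.1 p.2 : Fin (n + 1) → α) := by
  have h := FP.id (enc : α × (Fin n → α) → List Bool)
  unfold Poly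
  convert h using 2 with p
  simp [enc, encodeTuple_succ]

theorem vecTail {n : ℕ} : Poly fun (v : Fin (n + 1) → α) i => v (Fin.succ i) := by
  have h := FP.snd (enc : (Fin (n + 1) → α) → List Bool)
  unfold Poly
  convert h using 2 with v
  simp [enc, encodeTuple_succ]

theorem proj {n : ℕ} (i : Fin n) : Poly fun v : Fin n → α => v i := by
  induction n with
  | zero => exact i.elim0
  | succ n ih =>
    refine Fin.cases ?_ (fun i => ?_) i
    · have h := FP.fst (enc : (Fin (n + 1) → α) → List Bool)
      unfold Poly
      convert h using 2 with v
      simp [enc, encodeTuple_succ]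
    · exact (ih i).comp vecTail

theorem ofFn {n : ℕ} {f : Fin n → α → β} (hf : ∀ i, Poly (f i)) : Poly fun a i => f i a := by
  induction n with
  | zero =>
    convert const (α := α) (![] : Fin 0 → β) using 2
  | succ n ih =>
    convert vecCons.comp₂ (hf 0) (ih fun i => hf i.succ) using 2 with a
    funext i
    refine Fin.cases ?_ (fun i => ?_) i <;> simp

end Poly

/-! ### Predicates decidable in polynomial time -/

/-- The predicate `S` is decidable in polynomial time. -/
def PolyPred (S : α → Prop) : Prop := Poly fun a => @decide (S a) (Classical.dec _)

namespace PolyPred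

theorem comp {S : β → Prop} {f : α → β} (hS : PolyPred S) (hf : Poly f) :
    PolyPred fun a => S (f a) := Poly.comp hS hf

theorem of_bool {c : α → Bool} (h : Poly c) : PolyPred fun a => c a = true := by
  exact Poly.congr h fun a => by simp

theorem not {S : α → Prop} (h : PolyPred S) : PolyPred fun a => ¬ S a := by
  exact ((Poly.of_finite Bool.not).comp h).congr fun a => by simp

theorem and {S S' : α → Prop} (h : PolyPred S) (h' : PolyPred S') :
    PolyPred fun a => S a ∧ S' a := by
  exact ((Poly.of_finite fun p : Bool × Bool => p.1 && p.2).comp₂ h h').congr fun a => by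
    by_cases h₁ : S a <;> by_cases h₂ : S' a <;> simp [h₁, h₂]

theorem congr {S S' : α → Prop} (h : PolyPred S) (hS : ∀ a, S' a ↔ S a) : PolyPred S' := by
  have : S' = S := funext fun a => propext (hS a)
  exact this ▸ h

theorem le {f g : α → ℕ} (hf : Poly f) (hg : Poly g) : PolyPred fun a => f a ≤ g a :=
  (of_bool (Poly.le.comp₂ hf hg)).congr fun a => by simp

theorem eq {f g : α → List Bool} (hf : Poly f) (hg : Poly g) : PolyPred fun a => f a = g a :=
  (of_bool (Poly.eq.comp₂ hf hg)).congr fun a => by simp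

open Classical in
theorem ite {S : α → Prop} {f g : α → β} (hS : PolyPred S) (hf : Poly f) (hg : Poly g) :
    Poly fun a => if S a then f a else g a := by
  exact (Poly.ite hS hf hg).congr fun a => by simp

end PolyPred

/-! ### Machines for computable predicates -/

/-- The classes are defined by monomials with positive exponent, up to constants; the additive
constant takes care of n = 0. -/
theorem polynomial_eval_le (p : Polynomial ℕ) :
    ∃ k > 0, ∃ c, ∀ n, p.eval n ≤ c * n ^ k + c := by
  have pow_le : ∀ {k k' : ℕ} (n : ℕ), k ≤ k' → n ^ k ≤ n ^ k' + 1 := by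
    intro k k' n h
    rcases Nat.eq_zero_or_pos n with rfl | hn
    · rcases Nat.eq_zero_or_pos k with rfl | hk
      · simp
      · simp [hk.ne']
    · exact (Nat.pow_le_pow_right hn h).trans (Nat.le_succ _)
  induction p using Polynomial.induction_on' with
  | add p q hp hq =>
    obtain ⟨k, hk, c, hp⟩ := hp
    obtain ⟨k', hk', c', hq⟩ := hq
    refine ⟨max k k', by omega, 2 * (c + c'), fun n => ?_⟩
    have h₁ := hp n
    have h₂ := hq n
    have h₃ := Nat.mul_le_mul_left c (pow_le n (le_max_left k k'))
    have h₄ := Nat.mul_le_mul_left c' (pow_le n (le_max_right k k'))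
    have h₅ := Nat.zero_le (c * n ^ max k k')
    have h₆ := Nat.zero_le (c' * n ^ max k k')
    rw [Polynomial.eval_add]
    nlinarith
  | monomial k a =>
    refine ⟨k + 1, by omega, a, fun n => ?_⟩
    rw [Polynomial.eval_monomial]
    have := Nat.mul_le_mul_left a (pow_le n (Nat.le_succ k))
    simpa [mul_add] using this

namespace Machine

variable {M : Machine} {A : Language Bool}

theorem next_eq_none {c : M.Cfg} (h : M.instr c.state = .accept ∨ M.instr c.state = .reject)
    (b : Bool) : M.next A b c = none := by
  rcases h with h | h <;> simp [next, h]

theorem eq_nil_of_run {c c' : M.Cfg} {bs : List Bool}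
    (h : M.instr c.state = .accept ∨ M.instr c.state = .reject) (hr : M.run A bs c = some c') :
    bs = [] ∧ c' = c := by
  cases bs with
  | nil => simpa [run, eq_comm] using hr
  | cons b bs => simp [run, next_eq_none h] at hr

/-- A machine decides the existence of an outcome `u` with `R u`, if each long sequence of choices
leads to an outcome and each successful outcome is attained. -/
theorem halts_and_accepts_of_outcomes {w : List Bool} {T : ℕ} {U : Type} (R : U → Prop)
    (h₁ : ∀ bs : List Bool, T ≤ bs.length → ∃ u, ∃ n ≤ T, ∃ c,
      M.run A (bs.take n) (M.init w) = some c ∧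
        (M.instr c.state = .accept ∧ R u ∨ M.instr c.state = .reject ∧ ¬ R u))
    (h₂ : ∀ u, R u → ∃ bs c, M.run A bs (M.init w) = some c ∧ M.instr c.state = .accept) :
    M.HaltsWithin A w T ∧ (M.Accepts A w ↔ ∃ u, R u) := by
  refine ⟨fun bs hbs => ?_, ?_, fun ⟨u, hu⟩ => h₂ u hu⟩
  · by_contra! hT
    obtain ⟨u, n, hn, c, hc, hu⟩ := h₁ bs hT.le
    obtain ⟨c', hc'⟩ := Option.isSome_iff_exists.1 hbs
    rw [← List.take_append_drop n bs, run_append_of_eq hc] at hc'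
    have := (eq_nil_of_run (by tauto) hc').1
    have := congrArg List.length this
    simp at this
    omega
  · rintro ⟨bs, c, hc, hacc⟩
    -- The accepting run may be shorter than T, so its choices are prolonged arbitrarily. The
    -- outcome found in this way is the same halting configuration, since a halted machine has no
    -- successor.
    obtain ⟨u, n, hn, c', hc', hu⟩ := h₁ (bs ++ List.replicate T false) (by simp)
    refine ⟨u, ?_⟩
    have : c' = c := by
      rcases le_total n bs.length with h | h
      · rw [List.take_append_of_le_length h] at hc'
        rw [← List.take_append_drop n bs, run_append_of_eq hc'] at hc
        exact (eq_nil_of_run (by tauto) hc).2.symm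
      · rw [List.take_append, List.take_of_length_le h, run_append_of_eq hc] at hc'
        exact (eq_nil_of_run (.inl hacc) hc').2
    subst this
    rcases hu with ⟨_, hu⟩ | ⟨hrej, _⟩
    · exact hu
    · simp [hacc] at hrej

end Machine

theorem stackMachine_init (N : ℕ) (Q : Type) [Finite Q] (start : Q)
    (instr : Q → Instr (Fin (N + 1)) Q) (w : List Bool) :
    (stackMachine N Q start instr).init w
      = ⟨start, fun k => update (fun _ => []) 0 w (k : ℕ)⟩ := by
  simp only [Machine.init, Machine.Cfg.mk.injEq, true_and]
  funext k
  by_cases hk : k = 0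
  · subst hk; simp
  · have : (k : ℕ) ≠ 0 := fun h => hk (Fin.ext h)
    simp [hk, this]

/-- The program of a machine that executes `p` and accepts if the top of stack `0` is `1`. -/
def deciderInstr (p : Prog) (N : ℕ) : p.Pos ⊕ Option Bool →
    Instr (Fin (N + 1)) (p.Pos ⊕ Option Bool)
  | .inl y => .move fun tops _ =>
    let r := p.step (X := p.Pos ⊕ Option Bool) .inl (.inr none) y (extendTops tops)
    (r.1, fun k => r.2 k)
  | .inr none => .move fun tops _ =>
    (.inr (some (extendTops tops 0 == some true)), fun _ => .keep)
  | .inr (some true) => .accept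
  | .inr (some false) => .reject

/-- The program computing the characteristic function is compiled, followed by one test of the top
bit. Nothing is guessed, so the outcomes form a one-point type. -/
theorem mem_P_of_polyPred {L : Language Bool} (h : PolyPred fun w => w ∈ L) : L ∈ P := by
  classical
  obtain ⟨r, p, n, hp⟩ := h
  obtain ⟨k, hk, c, hr⟩ := polynomial_eval_le r
  let M := stackMachine p.bound (p.Pos ⊕ Option Bool) (.inl p.entry) (deciderInstr p p.bound)
  have key : ∀ w, M.HaltsWithin 0 w (r.eval w.length + 1) ∧
      (M.Accepts 0 w ↔ ∃ _ : Unit, w ∈ L) := by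
    intro w
    obtain ⟨t, ht, hexec⟩ := hp w (update (fun _ => []) 0 w) (by simp [Code.enc])
      (by intro i hi; simp [hi.ne'])
    have hrun : ∀ bs : List Bool, bs.length = t + 1 → ∃ c, M.run 0 bs (M.init w)
        = some c ∧ (M.instr c.state = .accept ∧ w ∈ L ∨ M.instr c.state = .reject ∧ w ∉ L) := by
      intro bs hbs
      have h₁ := run_of_exec (N := p.bound) (Q := p.Pos ⊕ Option Bool) (start := .inl p.entry)
        (instr := deciderInstr p p.bound) 0 hexec .inl (.inr none) (fun y => rfl) (by omega)
        (bs.take t) (by simp; omega)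
      obtain ⟨b, hb⟩ := List.length_eq_one_iff.1 (show (bs.drop t).length = 1 by simp; omega)
      rw [← List.take_append_drop t bs, stackMachine_init, Machine.run_append_of_eq h₁, hb,
        Machine.run_single]
      refine ⟨_, next_of_move (Q := p.Pos ⊕ Option Bool) (start := .inl p.entry)
        (instr := deciderInstr p p.bound) 0 b _ _
        (fun tops _ => (.inr (some (tops 0 == some true)), fun _ => .keep)) rfl _ _ _ rfl rfl
        (fun _ _ => rfl), ?_⟩
      by_cases hw : w ∈ L <;> simp [hw, M, deciderInstr, Code.enc]
    refine Machine.halts_and_accepts_of_outcomes (fun _ => w ∈ L) ?_ ?_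
    · intro bs hbs
      obtain ⟨c, hc⟩ := hrun (bs.take (t + 1)) (by simp [Code.enc] at ht ⊢; omega)
      exact ⟨(), t + 1, by simpa [Code.enc] using ht, c, hc⟩
    · intro _ hw
      obtain ⟨c, hc, hc'⟩ := hrun (List.replicate (t + 1) false) (by simp)
      exact ⟨_, c, hc, by tauto⟩
  refine ⟨k, hk, M, ?_, ?_, fun w => ?_, c + 1, fun w bs hbs => ?_⟩
  · rintro (y | _ | _ | _) δ hδ tops <;> simp [M, deciderInstr] at hδ <;> subst hδ <;> rfl
  · rintro (y | _ | _ | _) yes no <;> simp [M, deciderInstr]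
  · simpa using (key w).2.symm
  · refine ((key w).1 bs hbs).trans ?_
    have := hr w.length
    simp only
    nlinarith [Nat.zero_le (w.length ^ k)]

/-! ### Guessing a word and asking one oracle question. -/

/-- The final and intermediate states of the machine `guessInstr`. -/
inductive GuessState where
  | guess
  | test
  | query (b : Bool)
  | halt (b : Bool)

instance : Finite GuessState :=
  Finite.of_injective (β := Option (Bool ⊕ Option Bool)) (fun
    | .guess => none
    | .test => some (.inr none)
    | .query b => some (.inl b)
    | .halt b => some (.inr (some b))) fun x y h => by
  cases x <;> cases y <;> simp_all

/-- The program of a machine that executes `p`, guesses a word on stack `n + 1` of the same length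
as the content of stack `n`, executes `q`, pops a bit from stack `0`, and asks the oracle about the
rest of stack `0`, comparing the answer with the bit. -/
def guessInstr (p q : Prog) (n N : ℕ) : p.Pos ⊕ q.Pos ⊕ GuessState →
    Instr (Fin (N + 1)) (p.Pos ⊕ q.Pos ⊕ GuessState)
  | .inl y => .move fun tops _ =>
    let r := p.step (X := p.Pos ⊕ q.Pos ⊕ GuessState) .inl (.inr (.inr .guess)) y (extendTops tops)
    (r.1, fun k => r.2 k)
  | .inr (.inl y) => .move fun tops _ =>
    let r := q.step (X := p.Pos ⊕ q.Pos ⊕ GuessState) (fun z => .inr (.inl z)) (.inr (.inr .test)) y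
      (extendTops tops)
    (r.1, fun k => r.2 k)
  | .inr (.inr .guess) => .move fun tops b =>
    (if extendTops tops n = none then .inr (.inl q.entry) else .inr (.inr .guess),
      fun k => if extendTops tops n = none then .keep else
        if (k : ℕ) = n then .pop else if (k : ℕ) = n + 1 then .push b else .keep)
  | .inr (.inr .test) => .move fun tops _ =>
    (.inr (.inr (.query (extendTops tops 0 == some true))),
      fun k => if (k : ℕ) = 0 then .pop else .keep)
  | .inr (.inr (.query b)) => .query (.inr (.inr (.halt b))) (.inr (.inr (.halt !b)))
  | .inr (.inr (.halt true)) => .accept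
  | .inr (.inr (.halt false)) => .reject

/-- The additional bit `b` is consumed by the step that finds stack `n` empty. Successive pushes
leave the guess reversed. -/
theorem run_guess (p q : Prog) {n N : ℕ} (hN : n + 1 ≤ N) (A : Language Bool)
    (start : p.Pos ⊕ q.Pos ⊕ GuessState) (l : List Bool) :
    ∀ (s : ℕ → List Bool) (bs : List Bool) (b : Bool), s n = l → bs.length = l.length →
      (stackMachine N _ start (guessInstr p q n N)).run A (bs ++ [b])
        ⟨.inr (.inr .guess), fun k => s k⟩ = some ⟨.inr (.inl q.entry), fun k =>
          update (update s n []) (n + 1) (bs.reverse ++ s (n + 1)) k⟩ := by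
  induction l with
  | nil =>
    intro s bs b hs hbs
    obtain rfl : bs = [] := by simpa using hbs
    rw [List.nil_append, Machine.run_single]
    refine next_of_move A b _ s (fun tops b => (if tops n = none then .inr (.inl q.entry) else
      .inr (.inr .guess), fun k => if tops n = none then .keep else
        if (k : ℕ) = n then .pop else if (k : ℕ) = n + 1 then .push b else .keep)) rfl _ _ _ rfl
        ?_ ?_
    · simp [hs]
    · intro k _
      simp [hs, StackOp.apply, update_eq_of_eq hs]
  | cons a l ih =>
    intro s bs b hs hbs
    obtain ⟨d, bs, rfl⟩ := List.exists_cons_of_length_eq_add_one hbs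
    have h₁ := next_of_move (start := start) A d (.inr (.inr .guess)) s (fun tops b =>
      (if tops n = none then .inr (.inl q.entry) else
      .inr (.inr .guess), fun k => if tops n = none then .keep else
        if (k : ℕ) = n then .pop else if (k : ℕ) = n + 1 then .push b else .keep))
      (instr := guessInstr p q n N) rfl
      (update (update s n l) (n + 1) (d :: s (n + 1))) (.inr (.inr .guess)) _ rfl
      (by simp [hs, show n < N + 1 by omega]) (by
        intro k _
        by_cases h₁ : k = n + 1
        · subst h₁; simp [hs, show n < N + 1 by omega, StackOp.apply]
        · by_cases h₂ : k = n
          · subst h₂; simp [hs, StackOp.apply, show k < N + 1 by omega]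
          · simp [h₁, h₂, hs, StackOp.apply, show n < N + 1 by omega])
    rw [← Machine.run_single] at h₁
    refine (Machine.run_append_of_eq (bs := [d]) (bs' := bs ++ [b]) h₁).trans ?_
    rw [ih _ bs b (by simp) (by simpa using hbs)]
    congr 2
    funext k
    by_cases h₁ : (k : ℕ) = n + 1
    · simp [h₁]
    · by_cases h₂ : (k : ℕ) = n <;> simp [h₁, h₂]

/-- Guess a word `u` of the same length as `ℓ w`, and ask the oracle a question computed from
`u` and `w`. -/
theorem guess_mem_NTIME {ℓ : List Bool → List Bool} {T : List Bool → ℕ}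
    (hℓ : Comp (fun w => w) ℓ T) {h : List Bool × List Bool → Bool × List Bool} (hh : Poly h) :
    ∃ r : Polynomial ℕ, ∀ (A : Language Bool) (t : ℕ → ℕ),
      (∃ c, ∀ w, T w + r.eval (w.length + (ℓ w).length) ≤ c * t w.length + c) →
      ({w | ∃ u : List Bool, u.length = (ℓ w).length ∧
        ((h (u, w)).2 ∈ A ↔ (h (u, w)).1 = true)} : Language Bool) ∈ NTIME A t := by
  classical
  obtain ⟨p, n₁, hp⟩ := hℓ.pair (Comp.id fun w => w)
  obtain ⟨r, q, n₂, hq⟩ := Poly.cons.comp hh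
  obtain ⟨n, hn, hn₁, hn₂⟩ : ∃ n, 0 < n ∧ n₁ ≤ n ∧ n₂ ≤ n := ⟨max n₁ n₂ + 1, by omega⟩
  replace hp := hp.mono hn₁ fun _ => le_rfl
  replace hq := hq.mono hn₂ fun _ => le_rfl
  -- The factor 200 generously covers the linear costs of pairing, splitting, guessing and marking.
  -- The second program runs on the pair of `u` and `w`, of length 2|u| + 1 + |w|, whence 2X + 1.
  refine ⟨200 * (Polynomial.X + 1) + r.comp (2 * Polynomial.X + 1), fun A t ⟨c, ht⟩ => ?_⟩
  let p' := Prog.seq p (.split n)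
  let q' := Prog.seq (.op 0 (.push false)) (.seq (.mark (n + 1) 0) q)
  let N := max (max p'.bound q'.bound) (n + 1)
  let M := stackMachine N _ (.inl p'.entry) (guessInstr p' q' n N)
  suffices key : ∀ w, M.HaltsWithin A w (c * t w.length + c) ∧ (M.Accepts A w ↔
      ∃ u : List Bool, u.length = (ℓ w).length ∧
        ((h (u, w)).2 ∈ A ↔ (h (u, w)).1 = true)) from
    ⟨M, fun w => (key w).2.symm, c, fun w => (key w).1⟩
  intro w
  obtain ⟨s₀, hs₀⟩ : ∃ s₀ : ℕ → List Bool, s₀ = update (fun _ => []) 0 w := ⟨_, rfl⟩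
  have hs0 : s₀ 0 = w := by simp [hs₀]
  have hsn : ∀ i, 0 < i → s₀ i = [] := by intro i hi; simp [hs₀, hi.ne']
  obtain ⟨t₁, ht₁, h₁⟩ := hp w s₀ hs0 fun i hi _ => hsn i hi
  obtain ⟨t₂, ht₂, h₂⟩ := exec_split (d := n) hn.ne' (s := update s₀ 0 (pair (ℓ w) w))
    (s' := update s₀ n (ℓ w).reverse)
    (by simp [hsn n hn, hn.ne', update_eq_of_eq hs0])
  have h₃ : ∀ u : List Bool, u.length = (ℓ w).length → ∃ t ≤ 1 + (5 * (ℓ w).length + 1) +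
      r.eval (2 * (ℓ w).length + 1 + w.length),
      Exec q' (update s₀ (n + 1) u.reverse) (update s₀ 0 ((h (u, w)).1 :: (h (u, w)).2)) t := by
    intro u hu
    have e₁ : Exec (.op 0 (.push false)) (update s₀ (n + 1) u.reverse)
        (update (update s₀ (n + 1) u.reverse) 0 (false :: w)) 1 :=
      (Exec.op _ _ _).cast (by simp [StackOp.apply, hs0]) rfl
    obtain ⟨t₃, ht₃, e₂⟩ := exec_mark (a := n + 1) (d := 0) (by omega)
      (s := update (update s₀ (n + 1) u.reverse) 0 (false :: w)) (s' := update s₀ 0 (pair u w))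
      (by
        funext i
        by_cases hi : i = 0
        · subst hi; simp [pair, encodeWord]
        · by_cases hi' : i = n + 1
          · subst hi'; simp [hsn]
          · simp [hi, hi'])
    obtain ⟨t₄, ht₄, e₃⟩ := hq.exec (u, w) (s := update s₀ 0 (pair u w))
      (s' := update s₀ 0 ((h (u, w)).1 :: (h (u, w)).2))
      (by intro i hi _; simp [hi.ne', hsn i hi]) (by simp) (by simp)
    simp [hu] at ht₃ ht₄
    exact ⟨_, by omega, e₁.seq (e₂.seq e₃)⟩
  have hbd : t₁ + t₂ + ((ℓ w).length + 1) + (1 + (5 * (ℓ w).length + 1) +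
      r.eval (2 * (ℓ w).length + 1 + w.length)) + 2 ≤ c * t w.length + c := by
    refine le_trans ?_ (ht w)
    have := polynomial_eval_mono r (show 2 * (ℓ w).length + 1 + w.length ≤
      2 * (w.length + (ℓ w).length) + 1 by omega)
    simp at ht₂
    simp at ht₁ ⊢
    omega
  -- Only the block of choices read during the guessing phase influences the run; the bits before
  -- and after it are consumed by deterministic steps. The number m of final steps may depend on
  -- `u`.
  have hrun : ∀ u : List Bool, u.length = (ℓ w).length → ∃ m, m + (t₁ + t₂ + (u.length + 1)) ≤
      c * t w.length + c ∧ ∀ bs₁ b bs₂, bs₁.length = t₁ + t₂ → bs₂.length = m →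
      ∃ c, M.run A (bs₁ ++ (u ++ [b]) ++ bs₂) (M.init w) = some c ∧
        M.instr c.state = if ((h (u, w)).2 ∈ A ↔ (h (u, w)).1 = true) then .accept
          else .reject := by
    intro u hu
    obtain ⟨t₃, ht₃, hq'⟩ := h₃ u hu
    refine ⟨t₃ + 2, by omega, fun bs₁ b bs₂ hbs₁ hbs₂ => ?_⟩
    have r₁ : M.run A bs₁ (M.init w) = some ⟨.inr (.inr .guess),
        fun k : Fin (N + 1) => update s₀ n (ℓ w).reverse k⟩ := by
      rw [stackMachine_init, ← hs₀]
      exact run_of_exec (Q := p'.Pos ⊕ q'.Pos ⊕ GuessState) A (h₁.seq h₂) .inl (.inr (.inr .guess)) (fun y => rfl)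
        (show p'.bound ≤ N + 1 by omega) bs₁ hbs₁
    have r₂ := run_guess p' q' (n := n) (N := N) (by omega) A (.inl p'.entry) (ℓ w).reverse
      (update s₀ n (ℓ w).reverse) u b (by simp) (by simpa using hu)
    have e₂ : update (update (update s₀ n (ℓ w).reverse) n []) (n + 1)
        (u.reverse ++ update s₀ n (ℓ w).reverse (n + 1)) = update s₀ (n + 1) u.reverse := by
      simp [hsn, update_eq_of_eq (hsn n hn)]
    rw [e₂] at r₂
    have r₃ := run_of_exec (Q := p'.Pos ⊕ q'.Pos ⊕ GuessState)
      (start := .inl p'.entry) (instr := guessInstr p' q' n N) A hq'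
      (fun z => .inr (.inl z)) (.inr (.inr .test)) (fun y => rfl)
      (show q'.bound ≤ N + 1 by omega) (bs₂.take t₃) (by simp; omega)
    obtain ⟨b₁, b₂, hb⟩ := List.length_eq_two.1
      (show (bs₂.drop t₃).length = 2 by simp; omega)
    have r₄ := next_of_move (Q := p'.Pos ⊕ q'.Pos ⊕ GuessState)
      (start := .inl p'.entry) (instr := guessInstr p' q' n N) A b₁
      (.inr (.inr .test)) (update s₀ 0 ((h (u, w)).1 :: (h (u, w)).2)) (fun tops _ =>
        (.inr (.inr (.query (tops 0 == some true))), fun k => if k = 0 then .pop else .keep))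
      rfl (update s₀ 0 (h (u, w)).2) (.inr (.inr (.query (h (u, w)).1))) _ rfl
      (by simp) (by
        intro k _
        by_cases hk : k = 0
        · subst hk; simp [StackOp.apply]
        · simp [hk, StackOp.apply])
    rw [Machine.run_append_of_eq ((Machine.run_append_of_eq r₁).trans r₂),
      ← List.take_append_drop t₃ bs₂, Machine.run_append_of_eq r₃, hb]
    rw [← Machine.run_single] at r₄
    rw [show [b₁, b₂] = [b₁] ++ [b₂] from rfl, Machine.run_append_of_eq r₄, Machine.run_single]
    refine ⟨_, rfl, ?_⟩
    by_cases hA : (h (u, w)).2 ∈ A <;> rcases hB : (h (u, w)).1 <;>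
      simp [M, hA, guessInstr]
  have hM := Machine.halts_and_accepts_of_outcomes (M := M) (A := A) (w := w)
    (T := c * t w.length + c)
    (fun u : {u : List Bool // u.length = (ℓ w).length} =>
      (h (u.1, w)).2 ∈ A ↔ (h (u.1, w)).1 = true) ?_ ?_
  · simpa using hM
  · intro bs hbs
    let u := (bs.drop (t₁ + t₂)).take (ℓ w).length
    have hu : u.length = (ℓ w).length := by
      simp only [u, List.length_take, List.length_drop]
      omega
    obtain ⟨m, hm, hr⟩ := hrun u hu
    obtain ⟨b, bs', hb⟩ : ∃ b bs', bs.drop (t₁ + t₂ + (ℓ w).length) = b :: bs' :=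
      List.exists_cons_of_length_pos (by simp; omega)
    have hbs' : bs'.length + 1 = bs.length - (t₁ + t₂ + (ℓ w).length) := by
      have := congrArg List.length hb
      simpa using this.symm
    obtain ⟨c', hc, hc'⟩ := hr (bs.take (t₁ + t₂)) b (bs'.take m) (by simp; omega)
      (by simp; omega)
    have hsplit : bs = bs.take (t₁ + t₂) ++ (u ++ [b]) ++ bs' := by
      have := List.take_append_drop (ℓ w).length (bs.drop (t₁ + t₂))
      rw [List.drop_drop, hb] at this
      conv_lhs => rw [← List.take_append_drop (t₁ + t₂) bs, ← this]
      simp [u]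
    refine ⟨⟨u, hu⟩, m + (t₁ + t₂ + (u.length + 1)), hm, c', ?_, ?_⟩
    · rw [← hc]
      congr 1
      conv_lhs => rw [hsplit]
      rw [List.take_append, List.take_of_length_le (by simp; omega)]
      congr 2
      simp
      omega
    · by_cases hR : (h (u, w)).2 ∈ A ↔ (h (u, w)).1 = true
      · exact .inl ⟨by rw [hc', if_pos hR], hR⟩
      · exact .inr ⟨by rw [hc', if_neg hR], hR⟩
  · rintro ⟨u, hu⟩ hR
    obtain ⟨m, hm, hr⟩ := hrun u hu
    obtain ⟨c', hc, hc'⟩ := hr (List.replicate (t₁ + t₂) false) false (List.replicate m false)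
      (by simp) (by simp)
    exact ⟨_, c', hc, by rw [hc', if_pos hR]⟩

/-! ### Simulation of machines by polynomial time functions -/

attribute [instance] Machine.finK Machine.finQ

namespace Machine

variable {M : Machine} {A : Language Bool}

/-- One step of `M` in which the oracle answers `ans`; nothing changes if `M` has halted. -/
def simStep (M : Machine) (ans b : Bool) (c : M.Cfg) : M.Cfg :=
  match M.instr c.state with
  | .accept => c
  | .reject => c
  | .query yes no => ⟨if ans then yes else no, c.stk⟩
  | .move δ =>
      let r := δ (fun k => (c.stk k).head?) b
      ⟨r.1, fun k => (r.2 k).apply (c.stk k)⟩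

open Classical in
/-- The configuration after `n` steps along the choices `ch`. -/
noncomputable def traj (M : Machine) (A : Language Bool) (ch : ℕ → Bool) (c : M.Cfg) : ℕ → M.Cfg
  | 0 => c
  | n + 1 => M.simStep (decide ((traj M A ch c n).stk M.queryStack ∈ A)) (ch n) (traj M A ch c n)

theorem simStep_of_accept {c : M.Cfg} (h : M.instr c.state = .accept) (ans b : Bool) :
    M.simStep ans b c = c := by simp [simStep, h]

theorem simStep_congr {c : M.Cfg} {ans ans' : Bool}
    (h : ∀ yes no, M.instr c.state = .query yes no → ans = ans') (b : Bool) :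
    M.simStep ans b c = M.simStep ans' b c := by
  unfold simStep
  split <;> rename_i h' <;> simp_all

open Classical in
theorem next_eq_simStep {b : Bool} {c : M.Cfg}
    (h : ¬ (M.instr c.state = .accept ∨ M.instr c.state = .reject)) :
    M.next A b c = some (M.simStep (decide (c.stk M.queryStack ∈ A)) b c) := by
  unfold next simStep
  split <;> rename_i h' <;> simp_all

/-- A trajectory is total and stands still once the machine has halted, so the corresponding run may
use fewer than n choices. -/
theorem exists_run_eq_traj (M : Machine) (A : Language Bool) (ch : ℕ → Bool) (c : M.Cfg) (n : ℕ) :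
    ∃ bs, M.run A bs c = some (M.traj A ch c n) := by
  induction n with
  | zero => exact ⟨[], rfl⟩
  | succ n ih =>
    obtain ⟨bs, hbs⟩ := ih
    by_cases h : M.instr (M.traj A ch c n).state = .accept ∨
        M.instr (M.traj A ch c n).state = .reject
    · refine ⟨bs, hbs.trans ?_⟩
      rcases h with h | h <;> simp [traj, simStep, h]
    · refine ⟨bs ++ [ch n], ?_⟩
      rw [run_append_of_eq hbs, run_single, next_eq_simStep h]
      rfl

theorem run_take_eq_traj {bs : List Bool} {c : M.Cfg} (h : (M.run A bs c).isSome)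
    {ch : ℕ → Bool} (hch : ∀ n, (hn : n < bs.length) → ch n = bs[n]) (n : ℕ) (hn : n ≤ bs.length) :
    M.run A (bs.take n) c = some (M.traj A ch c n) := by
  induction n with
  | zero => rfl
  | succ n ih =>
    have ih := ih (by omega)
    rw [← List.take_append_getElem (by omega), run_append_of_eq ih, run_single, ← hch n]
    by_cases h' : M.instr (M.traj A ch c n).state = .accept ∨
        M.instr (M.traj A ch c n).state = .reject
    · obtain ⟨c', hc'⟩ := Option.isSome_iff_exists.1 h
      rw [← List.take_append_drop n bs, run_append_of_eq ih] at hc'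
      have := congrArg List.length (eq_nil_of_run h' hc').1
      simp at this
      omega
    · rw [next_eq_simStep h']
      rfl

theorem traj_of_accept {ch : ℕ → Bool} {c : M.Cfg} {n m : ℕ}
    (h : M.instr (M.traj A ch c n).state = .accept) (hm : n ≤ m) :
    M.traj A ch c m = M.traj A ch c n := by
  induction m, hm using Nat.le_induction with
  | base => rfl
  | succ m _ ih =>
    rw [traj, ih, simStep_of_accept h]

theorem traj_congr {ch ch' : ℕ → Bool} {c : M.Cfg} {n : ℕ} (h : ∀ m < n, ch m = ch' m) :
    M.traj A ch c n = M.traj A ch' c n := by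
  induction n with
  | zero => rfl
  | succ n ih => rw [traj, traj, ih fun m hm => h m (by omega), h n (by omega)]

theorem accepts_of_traj {ch : ℕ → Bool} {w : List Bool} {n : ℕ}
    (h : M.instr (M.traj A ch (M.init w) n).state = .accept) : M.Accepts A w := by
  obtain ⟨bs, hbs⟩ := M.exists_run_eq_traj A ch (M.init w) n
  exact ⟨bs, _, hbs, h⟩

/-- An accepting computation is a trajectory that is in an accepting state from some moment on. -/
theorem Accepts.exists_traj {w : List Bool} {T : ℕ} (h : M.Accepts A w)
    (hT : M.HaltsWithin A w T) :
    ∃ n ≤ T, ∃ ch, M.instr (M.traj A ch (M.init w) n).state = .accept := by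
  obtain ⟨bs, c, hc, hacc⟩ := h
  have hs : (M.run A bs (M.init w)).isSome := by simp [hc]
  refine ⟨bs.length, hT bs hs, fun n => bs.getD n false, ?_⟩
  have := run_take_eq_traj hs (ch := fun n => bs.getD n false)
    (fun n hn => by simp [hn]) bs.length le_rfl
  rw [List.take_length, hc] at this
  rwa [← Option.some.inj this]

theorem length_simStep_le (M : Machine) (ans b : Bool) (c : M.Cfg) (k : M.K) :
    ((M.simStep ans b c).stk k).length ≤ (c.stk k).length + 1 := by
  unfold simStep
  split <;> simp [StackOp.length_apply]

theorem length_traj_le (M : Machine) (A : Language Bool) (ch : ℕ → Bool) (w : List Bool) (n : ℕ)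
    (k : M.K) : ((M.traj A ch (M.init w) n).stk k).length ≤ w.length + n := by
  induction n with
  | zero =>
    simp only [traj, init]
    split_ifs <;> simp
  | succ n ih =>
    have := M.length_simStep_le (open Classical in
      decide ((traj M A ch (M.init w) n).stk M.queryStack ∈ A)) (ch n) (M.traj A ch (M.init w) n) k
    rw [traj]
    omega

/-! #### The code of a configuration -/

/-- The state and the stacks of a configuration, indexed by numbers. -/
noncomputable def Cfg.data (c : M.Cfg) : Fin (Nat.card M.Q) × (Fin (Nat.card M.K) → List Bool) :=
  (Finite.equivFin M.Q c.state, fun i => c.stk ((Finite.equivFin M.K).symm i))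

theorem Cfg.data_injective : Injective (Cfg.data : M.Cfg → _) := by
  rintro ⟨q, s⟩ ⟨q', s'⟩ h
  simp only [data, Prod.mk.injEq, EmbeddingLike.apply_eq_iff_eq] at h
  obtain ⟨rfl, h⟩ := h
  congr 1
  funext k
  simpa using congrFun h (Finite.equivFin M.K k)

noncomputable instance : Code M.Cfg :=
  ⟨fun c => Code.enc c.data, Code.enc_injective.comp Cfg.data_injective⟩

end Machine

open Machine

namespace Poly

variable {M : Machine}

theorem data : Poly (Cfg.data : M.Cfg → _) := FP.id _

theorem of_data {f : α → M.Cfg} (hf : Poly fun a => (f a).data) : Poly f := hf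

theorem of_state (f : M.Q → β) : Poly fun c : M.Cfg => f c.state :=
  ((of_finite fun i => f ((Finite.equivFin M.Q).symm i)).comp data.fst_comp).congr fun c => by
    simp [Cfg.data]

theorem stk (k : M.K) : Poly fun c : M.Cfg => c.stk k :=
  ((proj (Finite.equivFin M.K k)).comp data.snd_comp).congr fun c => by simp [Cfg.data]

theorem cfg (q : M.Q) {f : M.K → α → List Bool} (hf : ∀ k, Poly (f k)) :
    Poly fun a => (⟨q, fun k => f k a⟩ : M.Cfg) := by
  have h : Poly fun a => (Finite.equivFin M.Q q, fun i => f ((Finite.equivFin M.K).symm i) a) :=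
    (const _).pair (ofFn fun i => hf ((Finite.equivFin M.K).symm i))
  exact of_data h

theorem init (M : Machine) : Poly M.init := by
  classical
  refine (cfg (M := M) M.start (f := fun k w => if k = M.inputStack then w else []) fun k => ?_).congr
    fun w => ?_
  · by_cases hk : k = M.inputStack
    · simpa [hk] using id
    · simpa [hk] using const []
  · unfold Machine.init
    congr 1

theorem stackOp (o : StackOp) : Poly o.apply := by
  cases o with
  | keep => exact id
  | pop => exact tail
  | push b => exact cons.comp₂ (const b) id

/-- Which operations are performed depends only on the state, the tops of the stacks and two bits, a
value in a finite type. For each such value the new configuration arises by fixed stack operations,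
so `finite_case_comp` applies. -/
theorem simStep (M : Machine) :
    Poly fun p : (Bool × Bool) × M.Cfg => M.simStep p.1.1 p.1.2 p.2 := by
  let f : ((Bool × Bool) × Fin (Nat.card M.Q)) × (Fin (Nat.card M.K) → Option Bool) →
      M.Cfg → M.Cfg := fun a c =>
    match M.instr ((Finite.equivFin M.Q).symm a.1.2) with
    | .accept => c
    | .reject => c
    | .query yes no => ⟨if a.1.1.1 then yes else no, c.stk⟩
    | .move δ =>
        let r := δ (fun k => a.2 (Finite.equivFin M.K k)) a.1.1.2
        ⟨r.1, fun k => (r.2 k).apply (c.stk k)⟩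
  have hf : ∀ a, Poly (f a) := by
    intro a
    simp only [f]
    split
    · exact id
    · exact id
    · exact cfg _ fun k => stk k
    · exact cfg _ fun k => (stackOp _).comp (stk k)
  have hd : Poly fun p : (Bool × Bool) × M.Cfg => p.2.data := data.comp snd
  refine (finite_case_comp ((fst.pair hd.fst_comp).pair (ofFn fun i =>
    head?.comp ((proj i).comp hd.snd_comp))) hf snd).congr fun p => ?_
  simp only [f, Machine.simStep, Cfg.data, Equiv.symm_apply_apply]

theorem length_encodeTuple {k : ℕ} (v : Fin k → List Bool) :
    (encodeTuple v).length = ∑ i, (2 * (v i).length + 1) := by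
  induction k with
  | zero => rfl
  | succ k ih => rw [encodeTuple_succ, length_pair, ih, Fin.sum_univ_succ]

/-- The growth per step is additive: the unary code of the state is bounded, and one more letter on
a stack costs two more in the code. Hence simulations can be iterated in polynomial time. -/
theorem length_enc_simStep_le (M : Machine) : ∃ C, ∀ ans b (c : M.Cfg),
    (enc (M.simStep ans b c)).length ≤ (enc c).length + C := by
  refine ⟨2 * Nat.card M.Q + ∑ i : Fin (Nat.card M.K), 2, fun ans b c => ?_⟩
  have hlen : ∀ c : M.Cfg, (enc c).length = 2 * (Finite.equivFin M.Q c.state : ℕ) + 1 +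
      ∑ i, (2 * (c.stk ((Finite.equivFin M.K).symm i)).length + 1) := by
    intro c
    simp only [enc, length_pair, length_encodeTuple]
    simp [Cfg.data]
  have h₁ : ∑ i, (2 * ((M.simStep ans b c).stk ((Finite.equivFin M.K).symm i)).length + 1) ≤
      ∑ i, (2 * (c.stk ((Finite.equivFin M.K).symm i)).length + 1) +
        ∑ i : Fin (Nat.card M.K), 2 := by
    rw [← Finset.sum_add_distrib]
    refine Finset.sum_le_sum fun i _ => ?_
    have := M.length_simStep_le ans b c ((Finite.equivFin M.K).symm i)
    omega
  have h₂ := (Finite.equivFin M.Q (M.simStep ans b c).state).2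
  rw [hlen, hlen]
  omega

end Poly

/-- The machine is simulated along the choices `false` for as many steps as its time bound allows.
By determinism any accepting computation may be assumed to use these choices, and acceptance
persists until the end of the simulation. -/
theorem polyPred_of_mem_P {L : Language Bool} (h : L ∈ P) : PolyPred fun w => w ∈ L := by
  obtain ⟨k, -, M, hdet, -, hL, c, hT⟩ := h
  obtain ⟨C, hC⟩ := Poly.length_enc_simStep_le M
  have h₀ : Poly fun c : M.Cfg => ((false, false), c) := (Poly.const (false, false)).pair Poly.id
  have hstep : Poly fun c : M.Cfg => M.simStep false false c :=
    ((Poly.simStep M).comp h₀).congr fun _ => rfl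
  have hit := hstep.iterate_nat_of_length_le C (hC false false)
  have htraj : ∀ n c, (fun c : M.Cfg => M.simStep false false c)^[n] c
      = M.traj 0 (fun _ => false) c n := by
    intro n c
    induction n with
    | zero => rfl
    | succ n ih =>
      rw [iterate_succ_apply', ih, traj]
      congr
      simp
  let p : Polynomial ℕ := Polynomial.C c * Polynomial.X ^ k + Polynomial.C c
  have h₁ : Poly fun w : List Bool => (p.eval w.length, M.init w) :=
    ((Poly.eval p).comp Poly.length).pair (Poly.init M)
  have h₂ : Poly fun w : List Bool => M.traj 0 (fun _ => false) (M.init w) (p.eval w.length) :=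
    (hit.comp h₁).congr fun w => (htraj _ _).symm
  have hχ := (Poly.of_state (M := M) fun q =>
    (open Classical in decide (M.instr q = .accept))).comp h₂
  refine (PolyPred.of_bool hχ).congr fun w => ?_
  simp only [decide_eq_true_eq]
  rw [hL]
  refine ⟨?_, accepts_of_traj⟩
  rintro ⟨bs, c', hc', hacc⟩
  have hnext : ∀ b b' c, M.next 0 b c = M.next 0 b' c := by
    intro b b' c
    unfold next
    split
    · rfl
    · rfl
    · rfl
    · rename_i δ h
      have : ∀ tops b, δ tops b = δ tops false := by
        rintro tops (_ | _)
        · rfl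
        · exact (hdet _ _ h tops).symm
      simp [this _ b, this _ b']
  have hrun : ∀ (bs : List Bool) c, M.run 0 bs c = M.run 0 (List.replicate bs.length false) c := by
    intro bs
    induction bs with
    | nil => simp
    | cons b bs ih =>
      intro c
      simp only [List.length_cons, List.replicate_succ, run, hnext b false]
      congr
      funext c
      exact ih c
  rw [hrun] at hc'
  have hs : (M.run 0 (List.replicate bs.length false) (M.init w)).isSome := by simp [hc']
  have h₁ := run_take_eq_traj hs (ch := fun _ => false) (by simp) _ le_rfl
  rw [List.take_length, hc'] at h₁
  have h₂ := hT w _ hs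
  rw [Option.some.inj h₁] at hacc
  rw [traj_of_accept hacc (by simpa [p] using h₂)]
  exact hacc

open Polynomial

/-! ### Certificates for nondeterministic oracle computations -/

/-- The words of `L` are those with a certificate, of length polynomial in `t`, where the
language of the pairs of a word and an invalid certificate belongs to `C`. -/
def Verifiable (C : Set (Language Bool)) (L : Language Bool) (t : ℕ → ℕ) : Prop :=
  ∃ D ∈ C, ∃ p : ℕ[X], (∀ w u, pair w u ∉ D → w ∈ L) ∧
    ∀ w ∈ L, ∃ u, u.length ≤ p.eval (w.length + t w.length) ∧ pair w u ∉ D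

/-- Iterating a simulation step that consumes a certificate. -/
theorem poly_iterate_sim {M : Machine} (a b : M.Cfg × List Bool → Bool)
    (ha : Poly a) (hb : Poly b) (v : List Bool → List Bool) (hv : Poly v)
    (hlen : ∀ u, (v u).length ≤ u.length) :
    Poly fun z : ℕ × (M.Cfg × List Bool) =>
      (fun s : M.Cfg × List Bool => (M.simStep (a s) (b s) s.1, v s.2))^[z.1] z.2 := by
  obtain ⟨C, hC⟩ := Poly.length_enc_simStep_le M
  refine Poly.iterate_nat_of_length_le (Poly.pair ?_ (hv.comp Poly.snd)) (2 * C) fun s => ?_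
  · exact ((Poly.simStep M).comp ((ha.pair hb).pair Poly.fst)).congr fun _ => rfl
  · have h₁ := hC (a s) (b s) s.1
    have h₂ := hlen s.2
    simp only [enc_prod, length_pair, enc_word]
    omega

theorem polyPred_accept (M : Machine) : PolyPred fun c : M.Cfg => M.instr c.state = .accept :=
  (PolyPred.of_bool (Poly.of_state (M := M) fun q =>
    (open Classical in decide (M.instr q = .accept)))).congr fun c => by simp

theorem poly_head : Poly fun u : List Bool => u.head? == some true :=
  ((Poly.of_finite fun o : Option Bool => o == some true).comp Poly.head?).congr fun _ => rfl

open Classical in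
-- A certificate consists of the nondeterministic choices alone, its length being the number of
-- simulated steps; queries are answered by deciding `A`.
theorem verifiable_of_mem_NTIME_P {A L : Language Bool} {t : ℕ → ℕ} (hA : A ∈ P)
    (hL : L ∈ NTIME A t) : Verifiable P L t := by
  obtain ⟨M, hacc, c, hT⟩ := hL
  let f : M.Cfg × List Bool → M.Cfg × List Bool := fun s =>
    (M.simStep (decide (s.1.stk M.queryStack ∈ A)) (s.2.head? == some true) s.1, s.2.tail)
  have hf : Poly fun z : ℕ × (M.Cfg × List Bool) => f^[z.1] z.2 :=
    poly_iterate_sim _ _ ((polyPred_of_mem_P hA).comp ((Poly.stk M.queryStack).comp Poly.fst))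
      (poly_head.comp Poly.snd) _ Poly.tail (by simp)
  have hit : ∀ n c u, f^[n] (c, u) = (M.traj A (fun i => u[i]? == some true) c n, u.drop n) := by
    intro n c u
    induction n with
    | zero => rfl
    | succ n ih => rw [iterate_succ_apply', ih]; simp [f, traj]
  have h₁ : Poly fun z : List Bool => ((unpair z).2.length, (M.init (unpair z).1, (unpair z).2)) :=
    (Poly.length.comp Poly.unpair.snd_comp).pair
      (((Poly.init M).comp Poly.unpair.fst_comp).pair Poly.unpair.snd_comp)
  have h₂ : Poly fun z : List Bool =>
      (f^[(unpair z).2.length] (M.init (unpair z).1, (unpair z).2)).1 :=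
    ((hf.comp h₁).fst_comp).congr fun _ => rfl
  refine ⟨{z | ¬ M.instr (f^[(unpair z).2.length] (M.init (unpair z).1, (unpair z).2)).1.state
    = .accept}, mem_P_of_polyPred ((polyPred_accept M).comp h₂).not, C c * X + C c, ?_, ?_⟩
  · intro w u h
    have h : ¬ ¬ M.instr (f^[(unpair (pair w u)).2.length] (M.init (unpair (pair w u)).1,
      (unpair (pair w u)).2)).1.state = .accept := h
    rw [not_not, hit] at h
    rw [hacc]
    simpa using accepts_of_traj h
  · intro w hw
    obtain ⟨n, hn, ch, hch⟩ := ((hacc w).1 hw).exists_traj (hT w)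
    refine ⟨(List.range n).map ch, ?_, ?_⟩
    · simp only [List.length_map, List.length_range, eval_add, eval_mul, eval_C, eval_X]
      nlinarith
    · change ¬ ¬ _
      rw [not_not, hit]
      simp only [unpair_pair, List.length_map, List.length_range]
      rw [← hch]
      congr 2
      refine traj_congr fun m hm => ?_
      simp [hm]

/-- The simulation step that reads the answer of the oracle and the choice of the machine from a
certificate. -/
def replayStep (M : Machine) (s : M.Cfg × List Bool) : M.Cfg × List Bool :=
  (M.simStep ((unpair s.2).1.head? == some true) ((unpair s.2).1.tail.head? == some true) s.1,
    (unpair s.2).2)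

theorem poly_replay (M : Machine) : Poly fun z : ℕ × (M.Cfg × List Bool) =>
    (replayStep M)^[z.1] z.2 := by
  have h : Poly fun s : M.Cfg × List Bool => (unpair s.2).1 :=
    (Poly.unpair.comp Poly.snd).fst_comp
  exact (poly_iterate_sim (M := M) (fun s => (unpair s.2).1.head? == some true)
    (fun s => (unpair s.2).1.tail.head? == some true) ((poly_head.comp h).congr fun _ => rfl)
    ((poly_head.comp (Poly.tail.comp h)).congr fun _ => rfl) (fun u => (unpair u).2)
    Poly.unpair.snd_comp fun u => by have := length_unpair_le u; omega).congr fun _ => rfl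

/-- The question about the certificate `z.2` on the word `z.1` that is determined by the guess
`v`: does it contain a wrong answer to a query? Negative answers are refuted by certificates for the
queried words, positive answers by their own certificates. -/
noncomputable def audit (M : Machine) (yes no : Bool × List Bool) (v : List Bool)
    (z : List Bool × List Bool) : Bool × List Bool :=
  open Classical in
  let s := (replayStep M)^[(unpair v).1.length] (M.init z.1, z.2)
  if ¬ M.instr ((replayStep M)^[z.2.length] (M.init z.1, z.2)).1.state = .accept then yes
  else if ∃ q q', M.instr s.1.state = .query q q' then
    if ((unpair s.2).1.head? == some true) = true then
      (true, pair (s.1.stk M.queryStack) (unpair s.2).1.tail.tail)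
    else (false, pair (s.1.stk M.queryStack) (unpair (unpair v).2).1)
  else no

theorem poly_audit (M : Machine) (yes no : Bool × List Bool) :
    Poly fun p : List Bool × List Bool => audit M yes no p.1 (unpair p.2) := by
  have hz : Poly fun p : List Bool × List Bool => unpair p.2 := Poly.unpair.comp Poly.snd
  have h0 : Poly fun p : List Bool × List Bool => (M.init (unpair p.2).1, (unpair p.2).2) :=
    ((Poly.init M).comp hz.fst_comp).pair hz.snd_comp
  have h1 : Poly fun p : List Bool × List Bool =>
      (replayStep M)^[(unpair p.1).1.length] (M.init (unpair p.2).1, (unpair p.2).2) :=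
    ((poly_replay M).comp ((Poly.length.comp (Poly.unpair.comp Poly.fst).fst_comp).pair h0)).congr
      fun _ => rfl
  have h2 : Poly fun p : List Bool × List Bool =>
      (replayStep M)^[(unpair p.2).2.length] (M.init (unpair p.2).1, (unpair p.2).2) :=
    ((poly_replay M).comp ((Poly.length.comp hz.snd_comp).pair h0)).congr fun _ => rfl
  have hq : PolyPred fun c : M.Cfg => ∃ q q', M.instr c.state = .query q q' :=
    (PolyPred.of_bool (Poly.of_state (M := M) fun q =>
      (open Classical in decide (∃ q₁ q₂, M.instr q = .query q₁ q₂)))).congr fun c => by simp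
  have he := (Poly.unpair.comp h1.snd_comp).fst_comp
  have hx := (Poly.stk M.queryStack).comp h1.fst_comp
  refine (PolyPred.ite ((polyPred_accept M).comp h2.fst_comp).not (Poly.const yes)
    (PolyPred.ite (hq.comp h1.fst_comp)
      (PolyPred.ite (PolyPred.of_bool (poly_head.comp he))
        ((Poly.const true).pair (Poly.pairWord.comp₂ hx (Poly.tail.comp (Poly.tail.comp he))))
        ((Poly.const false).pair (Poly.pairWord.comp₂ hx
          (Poly.unpair.comp (Poly.unpair.comp Poly.fst).snd_comp).fst_comp)))
      (Poly.const no))).congr fun p => ?_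
  simp only [audit]
  split_ifs <;> rfl

theorem guess_mem_NP {𝒞 : Set (Language Bool)} {D : Language Bool} (hD : D ∈ 𝒞)
    {h : List Bool × List Bool → Bool × List Bool} (hh : Poly h) {ℓ : List Bool → List Bool}
    (hℓ : Poly ℓ) :
    ({z | ∃ v : List Bool, v.length = (ℓ z).length ∧
      ((h (v, z)).2 ∈ D ↔ (h (v, z)).1 = true)} : Language Bool) ∈ NP 𝒞 := by
  obtain ⟨p, hp⟩ := hℓ.length_le
  obtain ⟨q, hq⟩ := hℓ
  obtain ⟨r, hr⟩ := guess_mem_NTIME hq hh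
  obtain ⟨k, hk, c, hc⟩ := polynomial_eval_le (q + r.comp (X + p))
  refine ⟨D, hD, k, hk, hr D (fun n => n ^ k) ⟨c, fun w => (add_le_add le_rfl ?_).trans
    ((eval_add (p := q) (q := r.comp (X + p)) (x := w.length)).symm.trans_le (hc w.length))⟩⟩
  rw [eval_comp]
  refine polynomial_eval_mono r ?_
  simpa using hp w

/-- A replay is genuine as long as the earlier recorded answers are right; entries at steps that are
not queries may contain any answer. -/
theorem replayStep_eq_traj {M : Machine} {A : Language Bool} {ch : ℕ → Bool} {w u : List Bool}
    {n : ℕ} (hch : ∀ m < n, ch m =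
      ((unpair ((replayStep M)^[m] (M.init w, u)).2).1.tail.head? == some true))
    (hans : ∀ m < n, ∀ q q', M.instr (M.traj A ch (M.init w) m).state = .query q q' →
      ((unpair ((replayStep M)^[m] (M.init w, u)).2).1.head? = some true ↔
        (M.traj A ch (M.init w) m).stk M.queryStack ∈ A)) :
    ((replayStep M)^[n] (M.init w, u)).1 = M.traj A ch (M.init w) n := by
  classical
  induction n with
  | zero => rfl
  | succ n ih =>
    have ih := ih (fun m hm => hch m (by omega)) fun m hm => hans m (by omega)
    rw [iterate_succ_apply', replayStep, ← hch n (by omega), ih, traj]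
    refine simStep_congr (fun q q' hq => ?_) _
    rw [Bool.eq_iff_iff]
    simpa using hans n (by omega) q q' hq

theorem replayStep_snd {M : Machine} (c : M.Cfg) (u : List Bool) (n : ℕ) :
    ((replayStep M)^[n] (c, u)).2 = (fun u => (unpair u).2)^[n] u := by
  induction n with
  | zero => rfl
  | succ n ih => rw [iterate_succ_apply', iterate_succ_apply', ← ih]; rfl

theorem unpair_iterate_flatMap (es : List (List Bool)) (n : ℕ) :
    (fun u => (unpair u).2)^[n] (es.flatMap encodeWord) = (es.drop n).flatMap encodeWord := by
  induction n with
  | zero => rfl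
  | succ n ih =>
    rw [iterate_succ_apply', ih]
    rcases h : es.drop n with _ | ⟨e, l⟩
    · rw [← List.drop_drop, h]
      simp [unpair]
    · have h' : es.drop (n + 1) = l := by rw [← List.drop_drop, h]; rfl
      rw [h', List.flatMap_cons]
      exact congrArg Prod.snd (unpair_pair e _)

theorem length_flatMap_encodeWord_le {es : List (List Bool)} {b : ℕ} (h : ∀ e ∈ es, e.length ≤ b) :
    es.length ≤ (es.flatMap encodeWord).length ∧
      (es.flatMap encodeWord).length ≤ es.length * (2 * b + 1) := by
  induction es with
  | nil => simp
  | cons e es ih =>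
    have h₁ := h e (by simp)
    have h₂ := ih fun e he => h e (by simp [he])
    simp only [List.flatMap_cons, List.length_append, List.length_cons, length_encodeWord, add_mul,
      one_mul]
    omega

/-- Certificates for machines whose oracle has certificates. -/
theorem Verifiable.of_mem_NTIME {𝒞 : Set (Language Bool)} {A L : Language Bool} {t : ℕ → ℕ} {k : ℕ}
    (hA : Verifiable 𝒞 A fun n => n ^ k) (hL : L ∈ NTIME A t) :
    Verifiable (NP 𝒞) L t := by
  classical
  obtain ⟨D, hD, p, hsound, hcompl⟩ := hA
  obtain ⟨M, hacc, c, hT⟩ := hL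
  -- The guessing machine always asks exactly one question. When the verdict is already known, it
  -- asks about the empty word, whose membership in `D` is a fixed bit.
  let yes : Bool × List Bool := (decide ([] ∈ D), [])
  let no : Bool × List Bool := (decide ([] ∉ D), [])
  have hyes : yes.2 ∈ D ↔ yes.1 = true := by simp [yes]
  have hno : ¬ (no.2 ∈ D ↔ no.1 = true) := by by_cases h : [] ∈ D <;> simp [no, h]
  -- `P` bounds the certificates of queried words in terms of their lengths. `Q` leaves room in a
  -- guess for a position (2m + 1 letters) and a certificate (2|y| + 1 letters), where m ≤ |z| and
  -- |y| ≤ P(2|z|) for the audited word z.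
  let P : ℕ[X] := p.comp (X + X ^ k)
  let Q : ℕ[X] := 2 * X + 2 + 2 * P.comp (2 * X)
  refine ⟨_, guess_mem_NP hD (poly_audit M yes no)
    (Poly.replicate.comp ((Poly.eval Q).comp Poly.length)),
    -- The number of steps times the coded length of one entry: answer bit, choice bit and a
    -- certificate.
    (C c * X + C c) * (2 * (2 + P.comp (X + (C c * X + C c))) + 1), ?_, ?_⟩
  · intro w u hwu
    have hwu : ∀ v : List Bool, v.length = Q.eval (pair w u).length →
        ¬ ((audit M yes no v (w, u)).2 ∈ D ↔ (audit M yes no v (w, u)).1 = true) := by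
      intro v hv h
      exact hwu ⟨v, by simpa using hv, by simpa using h⟩
    have hfin : M.instr ((replayStep M)^[u.length] (M.init w, u)).1.state = .accept := by
      by_contra h
      refine hwu (List.replicate (Q.eval (pair w u).length) false) (by simp) ?_
      rw [audit, if_pos h]
      exact hyes
    let ch : ℕ → Bool := fun m =>
      (unpair ((replayStep M)^[m] (M.init w, u)).2).1.tail.head? == some true
    -- By strong induction the replay is faithful up to step m, so the word audited there is the
    -- word the machine really queries; an audit that finds no fault then proves the m-th answer
    -- right.
    have key : ∀ n ≤ u.length,
        ((replayStep M)^[n] (M.init w, u)).1 = M.traj A ch (M.init w) n := by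
      intro n
      induction n using Nat.strong_induction_on with
      | _ n ih =>
        intro hn
        refine replayStep_eq_traj (fun m _ => rfl) fun m hm q q' hq => ?_
        have ih := ih m hm (by omega)
        have hlen := M.length_traj_le A ch w m M.queryStack
        have haudit : ∀ y : List Bool, (encodeWord (List.replicate m true) ++ encodeWord y).length ≤
            Q.eval (pair w u).length →
            ¬ ((if ((unpair ((replayStep M)^[m] (M.init w, u)).2).1.head? == some true) = true then
              (true, pair ((M.traj A ch (M.init w) m).stk M.queryStack)
                (unpair ((replayStep M)^[m] (M.init w, u)).2).1.tail.tail)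
              else (false, pair ((M.traj A ch (M.init w) m).stk M.queryStack) y)).2 ∈ D ↔
              (if ((unpair ((replayStep M)^[m] (M.init w, u)).2).1.head? == some true) = true then
              (true, pair ((M.traj A ch (M.init w) m).stk M.queryStack)
                (unpair ((replayStep M)^[m] (M.init w, u)).2).1.tail.tail)
              else (false, pair ((M.traj A ch (M.init w) m).stk M.queryStack) y)).1 = true) := by
          intro y hy
          -- Guesses have one prescribed length, so the position and the certificate are padded to
          -- it; unpairing ignores the padding.
          have h := hwu (pair (List.replicate m true) (pair y (List.replicate
            (Q.eval (pair w u).length - (encodeWord (List.replicate m true) ++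
              encodeWord y).length) false))) (by
              simp only [List.length_append, length_encodeWord, List.length_replicate] at hy
              simp only [length_pair w u, length_pair, List.length_append, length_encodeWord,
                List.length_replicate] at hy ⊢
              omega)
          have hq' : ∃ q q', M.instr (M.traj A ch (M.init w) m).state = .query q q' := ⟨q, q', hq⟩
          rw [audit, if_neg (not_not.2 hfin)] at h
          simp only [unpair_pair, List.length_replicate] at h
          rw [ih, if_pos hq'] at h
          exact h
        have hQ : ∀ y : List Bool, y.length ≤ P.eval (2 * (pair w u).length) →
            (encodeWord (List.replicate m true) ++ encodeWord y).length ≤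
              Q.eval (pair w u).length := by
          intro y hy
          have h₁ : m ≤ (pair w u).length := by simp; omega
          have h₂ : Q.eval (pair w u).length = 2 * (pair w u).length + 2 +
            2 * P.eval (2 * (pair w u).length) := by simp [Q]
          rw [h₂]
          simp only [List.length_append, length_encodeWord, List.length_replicate]
          omega
        by_cases hans : (unpair ((replayStep M)^[m] (M.init w, u)).2).1.head? = some true
        · have h := haudit [] (hQ [] (by simp))
          simp only [hans, beq_self_eq_true, if_true, iff_true] at h
          exact iff_of_true hans (hsound _ _ h)
        · refine iff_of_false hans fun hx => ?_
          obtain ⟨y, hy, hyD⟩ := hcompl _ hx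
          have h := haudit y (hQ y (hy.trans ?_))
          · simp only [beq_iff_eq, hans, if_false, Bool.false_eq_true, iff_false, not_not] at h
            exact hyD h
          · have hle : ((M.traj A ch (M.init w) m).stk M.queryStack).length ≤
                2 * (pair w u).length := by simp; omega
            have := polynomial_eval_mono P hle
            simpa [P] using this
    rw [hacc]
    rw [key _ le_rfl] at hfin
    exact accepts_of_traj hfin
  · intro w hw
    obtain ⟨n, hn, ch, hch⟩ := ((hacc w).1 hw).exists_traj (hT w)
    have hcert : ∀ m, ∃ e : List Bool, (e.head? = some true ↔
        (M.traj A ch (M.init w) m).stk M.queryStack ∈ A) ∧ e.tail.head? = some (ch m) ∧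
        (e.head? = some true →
          pair ((M.traj A ch (M.init w) m).stk M.queryStack) e.tail.tail ∉ D) ∧
        e.length ≤ 2 + P.eval (w.length + m) := by
      intro m
      by_cases hx : (M.traj A ch (M.init w) m).stk M.queryStack ∈ A
      · obtain ⟨y, hy, hyD⟩ := hcompl _ hx
        refine ⟨true :: ch m :: y, by simp [hx], by simp, by simpa using hyD, ?_⟩
        have := polynomial_eval_mono P (M.length_traj_le A ch w m M.queryStack)
        simp [P] at hy this ⊢
        omega
      · exact ⟨[false, ch m], by simp [hx], by simp, by simp, by simp⟩
    choose e he₁ he₂ he₃ he₄ using hcert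
    let es := (List.range n).map e
    have hes : es.length = n := by simp [es]
    let u := es.flatMap encodeWord
    have hlen := length_flatMap_encodeWord_le (es := es) (b := 2 + P.eval (w.length + n)) (by
      intro x hx
      obtain ⟨m, hm, rfl⟩ := List.mem_map.1 hx
      rw [List.mem_range] at hm
      have := polynomial_eval_mono P (show w.length + m ≤ w.length + n by omega)
      exact (he₄ m).trans (by omega))
    rw [hes] at hlen
    have hentry : ∀ m < n, (unpair ((replayStep M)^[m] (M.init w, u)).2).1 = e m := by
      intro m hm
      rw [replayStep_snd, unpair_iterate_flatMap, List.drop_eq_getElem_cons (by omega),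
        List.flatMap_cons]
      refine (congrArg Prod.fst (unpair_pair _ _)).trans ?_
      simp [es]
    have htraj : ∀ m ≤ n, ((replayStep M)^[m] (M.init w, u)).1 = M.traj A ch (M.init w) m := by
      intro m hm
      refine replayStep_eq_traj (fun i hi => ?_) fun i hi q q' _ => ?_
      · rw [hentry i (by omega), he₂]
        simp
      · rw [hentry i (by omega), he₁]
    have hhalt : ∀ m, n ≤ m →
        ((replayStep M)^[m] (M.init w, u)).1 = M.traj A ch (M.init w) n := by
      intro m hm
      induction m, hm using Nat.le_induction with
      | base => exact htraj n le_rfl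
      | succ m _ ih =>
        rw [iterate_succ_apply', replayStep, ih, simStep_of_accept hch]
    refine ⟨u, ?_, ?_⟩
    · refine hlen.2.trans ?_
      have h₁ : n ≤ c * (w.length + t w.length) + c := hn.trans (by nlinarith)
      have h₂ := polynomial_eval_mono P
        (show w.length + n ≤ w.length + t w.length + (c * (w.length + t w.length) + c) by omega)
      simp only [eval_mul, eval_add, eval_C, eval_X, eval_comp, eval_one, eval_ofNat]
      exact Nat.mul_le_mul h₁ (by omega)
    · rintro ⟨v, -, hv⟩
      simp only [unpair_pair] at hv
      -- The replay lasts |u| steps, which is at least the number n of entries; from step n on it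
      -- rests in the accepting configuration.
      rw [audit, if_neg (by rw [hhalt _ hlen.1]; exact not_not.2 hch)] at hv
      by_cases hm : (unpair v).1.length < n
      · have ht := htraj _ hm.le
        have hen := hentry _ hm
        simp only [ht, hen] at hv
        split_ifs at hv with hq ha
        · simp only [beq_iff_eq] at ha
          simp only [iff_true] at hv
          exact he₃ _ ha hv
        · simp only [beq_iff_eq, he₁] at ha
          simp only [iff_false] at hv
          exact ha (hsound _ _ hv)
        · exact hno hv
      -- A guessed position after the end of the computation points at an accepting state, which is
      -- not a query, so nothing is objected to.
      · simp only [hhalt _ (not_lt.1 hm)] at hv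
        rw [if_neg (by simp [hch])] at hv
        exact hno hv

/-- The languages accepted with an oracle of the polynomial hierarchy have certificates of the
same level. -/
theorem verifiable_of_mem_NTIME (i : ℕ) {A L : Language Bool} {t : ℕ → ℕ} (hA : A ∈ SigmaP i)
    (hL : L ∈ NTIME A t) : Verifiable (SigmaP i) L t := by
  induction i generalizing A L t with
  | zero => exact verifiable_of_mem_NTIME_P hA hL
  | succ i ih =>
    obtain ⟨A', hA', k, -, hA⟩ := hA
    exact (ih hA' hA).of_mem_NTIME hL

/-! ### Alternating quantifiers -/

theorem altQuant_not (ℓ : ℕ) (b : Bool) {k : ℕ} (φ : (Fin k → List Bool) → Prop) :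
    AltQuant ℓ b k (fun v => ¬ φ v) ↔ ¬ AltQuant ℓ (!b) k φ := by
  induction k generalizing b with
  | zero => cases b <;> rfl
  | succ k ih => cases b <;> simp [AltQuant, ih]

theorem altQuant_and (ℓ : ℕ) (b : Bool) {k : ℕ} (c : Prop) (φ : (Fin k → List Bool) → Prop) :
    AltQuant ℓ b k (fun v => c ∧ φ v) ↔ c ∧ AltQuant ℓ b k φ := by
  induction k generalizing b with
  | zero => cases b <;> rfl
  | succ k ih =>
    cases b
    · simp only [AltQuant, ih]
      -- Extracting `c` from a universal quantifier needs some word of length ℓ.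
      exact ⟨fun h => ⟨(h (List.replicate ℓ true) (by simp)).1, fun u hu => (h u hu).2⟩,
        fun h u hu => ⟨h.1, h.2 u hu⟩⟩
    · simp only [AltQuant, ih]
      tauto

/-! ### Polynomial time predicates on tuples -/

theorem exists_poly_decode (k : ℕ) :
    ∃ d : List Bool → Fin k → List Bool, Poly d ∧ ∀ x, d (encodeTuple x) = x := by
  induction k with
  | zero => exact ⟨fun _ => ![], Poly.const _, fun x => Subsingleton.elim _ _⟩
  | succ k ih =>
    obtain ⟨d, hd, h⟩ := ih
    refine ⟨fun u => Matrix.vecCons (unpair u).1 (d (unpair u).2), ?_, fun x => ?_⟩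
    · exact (Poly.vecCons.comp (Poly.unpair.fst_comp.pair (hd.comp Poly.unpair.snd_comp))).congr
        fun _ => rfl
    · simp only [encodeTuple_succ, unpair_pair, h]
      funext i
      refine Fin.cases ?_ (fun i => ?_) i <;> simp

theorem polyTimeDecidable_iff {k : ℕ} {R : (Fin k → List Bool) → Prop} :
    PolyTimeDecidable R ↔ PolyPred R := by
  constructor
  · intro h
    have h' : PolyPred fun x : Fin k → List Bool =>
        enc x ∈ ({u | ∃ x, u = encodeTuple x ∧ R x} : Language Bool) :=
      (polyPred_of_mem_P h).comp Poly.encode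
    refine h'.congr fun x => ⟨fun hx => ⟨x, rfl, hx⟩, ?_⟩
    rintro ⟨y, hy, hR⟩
    have e : x = y := encodeTuple_injective k hy
    exact e ▸ hR
  · intro h
    obtain ⟨d, hd, hdec⟩ := exists_poly_decode k
    -- Words that are not codes of tuples must be rejected; they are recognised by decoding and
    -- encoding again.
    refine mem_P_of_polyPred (((PolyPred.eq (Poly.encode.comp hd) Poly.id).and (h.comp hd)).congr
      fun u => ?_)
    constructor
    · rintro ⟨x, rfl, hx⟩
      rw [hdec]
      exact ⟨rfl, hx⟩
    · rintro ⟨h₁, h₂⟩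
      exact ⟨d u, h₁.symm, h₂⟩

/-! ### From certificates to alternating quantifiers -/

/-- The certificate becomes the first existential word, and negating the description of `D` turns
its ∃-block into the ∀-block that follows. The lower bound on ℓ makes room for the coded certificate
(2p + 1) and lets the description of `D` apply to the pair (the `p'` term). -/
theorem exists_altQuant_of_verifiable {j : ℕ} {D L : Language Bool} {t : ℕ → ℕ} {p p' : ℕ[X]}
    (hsound : ∀ w u, pair w u ∉ D → w ∈ L)
    (hcompl : ∀ w ∈ L, ∃ u, u.length ≤ p.eval (w.length + t w.length) ∧ pair w u ∉ D)
    {R' : (Fin (j + 1) → List Bool) → Prop} (hR' : PolyPred R')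
    (hD : ∀ x ℓ, p'.eval x.length ≤ ℓ →
      (x ∈ D ↔ AltQuant ℓ true j fun v => R' (Matrix.vecCons x v))) :
    ∃ R : (Fin (j + 2) → List Bool) → Prop, PolyPred R ∧ ∀ x ℓ,
      2 * p.eval (x.length + t x.length) + 1 +
        p'.eval (2 * x.length + 1 + p.eval (x.length + t x.length)) ≤ ℓ →
      (x ∈ L ↔ AltQuant ℓ true (j + 1) fun v => R (Matrix.vecCons x v)) := by
  let z : (Fin (j + 2) → List Bool) → List Bool := fun y => pair (y 0) (unpair (y 1)).1
  have hz : Poly z := Poly.pairWord.comp₂ (Poly.proj 0) (Poly.unpair.comp (Poly.proj 1)).fst_comp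
  have hv : Poly fun y : Fin (j + 2) → List Bool =>
      (Matrix.vecCons (z y) (fun i : Fin j => y i.succ.succ) : Fin (j + 1) → List Bool) :=
    (Poly.vecCons.comp (hz.pair (Poly.ofFn (f := fun (i : Fin j) (y : Fin (j + 2) → List Bool) =>
      y i.succ.succ) fun i => Poly.proj i.succ.succ))).congr fun _ => rfl
  -- A word of length ℓ may code a certificate too long for the description of `D` to be valid at ℓ;
  -- this polynomial-time test, in which ℓ is the length of the first quantified word, excludes it.
  refine ⟨fun y => p'.eval (z y).length ≤ (y 1).length ∧
      ¬ R' (Matrix.vecCons (z y) fun i => y i.succ.succ),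
    (PolyPred.le ((Poly.eval p').comp (Poly.length.comp hz))
      (Poly.length.comp (Poly.proj 1))).and (hR'.comp hv).not, fun x ℓ hℓ => ?_⟩
  have key : ∀ u : List Bool, u.length = ℓ →
      (AltQuant ℓ false j (fun v => p'.eval (z (Matrix.vecCons x (Matrix.vecCons u v))).length ≤
        (Matrix.vecCons x (Matrix.vecCons u v) 1).length ∧
        ¬ R' (Matrix.vecCons (z (Matrix.vecCons x (Matrix.vecCons u v)))
          fun i => (Matrix.vecCons x (Matrix.vecCons u v) : Fin (j + 2) → List Bool) i.succ.succ)) ↔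
      p'.eval (pair x (unpair u).1).length ≤ ℓ ∧ pair x (unpair u).1 ∉ D) := by
    intro u hu
    simp only [z, Matrix.cons_val_zero, Matrix.cons_val_one, Matrix.cons_val_succ, hu]
    rw [altQuant_and, altQuant_not]
    exact and_congr_right fun h => not_congr (hD _ _ h).symm
  simp only [AltQuant]
  constructor
  · intro hx
    obtain ⟨u, hu, huD⟩ := hcompl x hx
    -- Padding behind a self-delimiting code gives the certificate the exact length ℓ.
    let u' := pair u (List.replicate (ℓ - (2 * u.length + 1)) true)
    have hu' : u'.length = ℓ := by simp [u']; omega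
    refine ⟨u', hu', (key u' hu').2 ?_⟩
    simp only [u', unpair_pair]
    refine ⟨le_trans (polynomial_eval_mono p' ?_) ((Nat.le_add_left _ _).trans hℓ), huD⟩
    simpa using hu
  · rintro ⟨u, hu, h⟩
    exact hsound _ _ ((key u hu).1 h).2

theorem exists_altQuant_of_mem_SigmaP (j : ℕ) {A : Language Bool} (hA : A ∈ SigmaP j) :
    ∃ R : (Fin (j + 1) → List Bool) → Prop, PolyPred R ∧ ∃ p : ℕ[X], ∀ x ℓ,
      p.eval x.length ≤ ℓ → (x ∈ A ↔ AltQuant ℓ true j fun v => R (Matrix.vecCons x v)) := by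
  induction j generalizing A with
  | zero =>
    exact ⟨fun y => y 0 ∈ A, (polyPred_of_mem_P hA).comp (Poly.proj 0), 0, fun x ℓ _ => Iff.rfl⟩
  | succ j ih =>
    obtain ⟨A', hA', k, -, hA⟩ := hA
    obtain ⟨D, hD, p, h₁, h₂⟩ := verifiable_of_mem_NTIME j hA' hA
    obtain ⟨R', hR', p', h₃⟩ := ih hD
    obtain ⟨R, hR, h⟩ := exists_altQuant_of_verifiable (t := fun n => n ^ k) h₁ h₂ hR' h₃
    refine ⟨R, hR, 2 * p.comp (X + X ^ k) + 1 + p'.comp (2 * X + 1 + p.comp (X + X ^ k)),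
      fun x ℓ hℓ => h x ℓ ?_⟩
    simpa using hℓ

/-! ### From alternating quantifiers to oracle machines -/

/-- The words `z` such that, for `y` the second component and `ℓ` the length of the first component
of `z`, the words `y ++ encodeTuple v` satisfy a condition with `j` alternating quantifiers over
words of length `ℓ`. -/
def altLanguage (j : ℕ) (D : Language Bool) : Language Bool :=
  {z | AltQuant (unpair z).1.length true j fun v => (unpair z).2 ++ encodeTuple v ∈ D}

/-- The ∀-block after the first quantifier is the negation of an ∃-block for the complement of `D`.
The word u plays two roles in the question: its length transmits ℓ, and its code is appended as the
first argument. -/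
theorem altQuant_succ_iff (j : ℕ) (D : Language Bool) (ℓ : ℕ) (y : List Bool) :
    AltQuant ℓ true (j + 1) (fun v => y ++ encodeTuple v ∈ D) ↔
      ∃ u : List Bool, u.length = ℓ ∧
        pair u (y ++ encodeWord u) ∉ altLanguage j {z | z ∉ D} := by
  simp only [AltQuant]
  refine exists_congr fun u => and_congr_right fun hu => ?_
  change _ ↔ ¬ AltQuant (unpair (pair u (y ++ encodeWord u))).1.length true j fun v =>
    ¬ (unpair (pair u (y ++ encodeWord u))).2 ++ encodeTuple v ∈ D
  rw [altQuant_not, not_not, unpair_pair, hu]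
  simp only [encodeTuple_cons, pair, List.append_assoc, Bool.not_true]

/-- As ℓ is the length of a part of the input, a word of length ℓ can be guessed in polynomial time;
one query one level below handles the rest, because P is closed under complements. -/
theorem altLanguage_mem_SigmaP (j : ℕ) {D : Language Bool} (hD : D ∈ P) :
    altLanguage j D ∈ SigmaP j := by
  induction j generalizing D with
  | zero =>
    refine mem_P_of_polyPred (((polyPred_of_mem_P hD).comp Poly.unpair.snd_comp).congr fun z => ?_)
    change AltQuant _ _ _ _ ↔ _
    simp [AltQuant, encodeTuple]
  | succ j ih =>
    have h : altLanguage j {z | z ∉ D} ∈ SigmaP j :=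
      ih (mem_P_of_polyPred (polyPred_of_mem_P hD).not)
    have hz : Poly fun p : List Bool × List Bool => unpair p.2 := Poly.unpair.comp Poly.snd
    have hh : Poly fun p : List Bool × List Bool =>
        (false, pair p.1 ((unpair p.2).2 ++ encodeWord p.1)) :=
      (Poly.const false).pair (Poly.pairWord.comp₂ Poly.fst
        (Poly.append.comp₂ hz.snd_comp (Poly.encodeWord.comp Poly.fst)))
    refine Eq.mpr (congrArg (· ∈ NP (SigmaP j)) (Set.ext fun z => ?_))
      (guess_mem_NP h hh Poly.unpair.fst_comp)
    change AltQuant _ _ _ _ ↔ ∃ _, _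
    rw [altQuant_succ_iff]
    simp

/-! ### Exponential bounds -/

/-- The function `f` is bounded by `2 ^ q n` for some polynomial `q`. -/
def ExpBounded (f : ℕ → ℕ) : Prop := ∃ q : ℕ[X], ∀ n, f n ≤ 2 ^ q.eval n

namespace ExpBounded

theorem two_pow (q : ℕ[X]) : ExpBounded fun n => 2 ^ q.eval n := ⟨q, fun _ => le_rfl⟩

theorem eval (q : ℕ[X]) : ExpBounded fun n => q.eval n := ⟨q, fun _ => Nat.lt_two_pow_self.le⟩

theorem add {f g : ℕ → ℕ} (hf : ExpBounded f) (hg : ExpBounded g) :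
    ExpBounded fun n => f n + g n := by
  obtain ⟨p, hp⟩ := hf
  obtain ⟨q, hq⟩ := hg
  refine ⟨p + q + 1, fun n => ?_⟩
  have h₁ := (hp n).trans (Nat.pow_le_pow_right two_pos (Nat.le_add_right (p.eval n) (q.eval n)))
  have h₂ := (hq n).trans (Nat.pow_le_pow_right two_pos (Nat.le_add_left (q.eval n) (p.eval n)))
  simp only [eval_add, eval_one, pow_succ]
  omega

theorem mul {f g : ℕ → ℕ} (hf : ExpBounded f) (hg : ExpBounded g) :
    ExpBounded fun n => f n * g n := by
  obtain ⟨p, hp⟩ := hf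
  obtain ⟨q, hq⟩ := hg
  refine ⟨p + q, fun n => ?_⟩
  rw [eval_add, pow_add]
  exact Nat.mul_le_mul (hp n) (hq n)

theorem const (c : ℕ) : ExpBounded fun _ => c := by simpa using eval (C c)

theorem polynomial {f : ℕ → ℕ} (hf : ExpBounded f) (p : ℕ[X]) :
    ExpBounded fun n => p.eval (f n) := by
  induction p using Polynomial.induction_on' with
  | add p q hp hq => simpa using hp.add hq
  | monomial k a =>
    simp only [eval_monomial]
    refine (const a).mul ?_
    induction k with
    | zero => simpa using const 1
    | succ k ih => simpa [pow_succ] using ih.mul hf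

theorem exists_le {f : ℕ → ℕ} (hf : ExpBounded f) :
    ∃ k > 0, ∃ c, ∀ n, f n ≤ c * 2 ^ n ^ k + c := by
  obtain ⟨q, hq⟩ := hf
  obtain ⟨k, -, c, hc⟩ := polynomial_eval_le q
  -- For n ≥ c the coefficient is absorbed by one more power of n, which leaves the factor 2^c; for
  -- n ≤ c the whole bound is at most the second summand.
  refine ⟨k + 1, by omega, 2 ^ c + 2 ^ (c * c ^ k + c), fun n => (hq n).trans ?_⟩
  refine (Nat.pow_le_pow_right two_pos (hc n)).trans ?_
  rcases le_total c n with h | h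
  · have : c * n ^ k ≤ n ^ (k + 1) := by
      rw [pow_succ, mul_comm]; exact Nat.mul_le_mul_left _ h
    have := Nat.pow_le_pow_right two_pos this
    rw [pow_add, mul_comm]
    exact (Nat.mul_le_mul (Nat.le_add_right _ _) this).trans (Nat.le_add_right _ _)
  · have : c * n ^ k + c ≤ c * c ^ k + c := by gcongr
    exact (Nat.pow_le_pow_right two_pos this).trans
      ((Nat.le_add_left _ _).trans (Nat.le_add_left _ _))

end ExpBounded

/-- A word of one letter is doubled q(n) times. Each doubling is polynomial in the current length,
which never exceeds 2^q(n), so the total time is exponentially bounded. -/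
theorem exists_comp_two_pow (q : ℕ[X]) : ∃ (ℓ : List Bool → List Bool) (T : ℕ → ℕ),
    (∀ w, (ℓ w).length = 2 ^ q.eval w.length) ∧ ExpBounded T ∧
      Comp (fun w => w) ℓ fun w => T w.length := by
  obtain ⟨d, hd⟩ : Poly fun w : List Bool => w ++ w :=
    Poly.append.comp₂ Poly.id Poly.id
  obtain ⟨r, hr⟩ : Poly fun w : List Bool => (List.replicate (q.eval w.length) true, [true]) :=
    (Poly.replicate.comp ((Poly.eval q).comp Poly.length)).pair (Poly.const [true])
  have hlen : ∀ (n : ℕ) (w : List Bool), ((fun w : List Bool => w ++ w)^[n] w).length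
      = 2 ^ n * w.length := by
    intro n w
    induction n with
    | zero => simp
    | succ n ih =>
      rw [iterate_succ_apply', List.length_append, ih, pow_succ]
      ring
  have h := (Comp.iterate (k := fun w : List Bool => w ++ w) (e := fun w => w) hd
    (fun z => d.eval (2 ^ z.1.length * z.2.length)) (fun z i hi => polynomial_eval_mono d (by
      simp only [enc_word]
      rw [hlen]
      exact Nat.mul_le_mul_right _ (Nat.pow_le_pow_right two_pos hi.le)))).precomp
    (fun w : List Bool => (List.replicate (q.eval w.length) true, [true]))
  refine ⟨_, fun n => r.eval n + (12 * q.eval n + 6 + 10 + q.eval n * (d.eval (2 ^ q.eval n) + 2)),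
    ?_, ?_, (h.comp hr).mono ?_⟩
  · intro w
    simp [hlen]
  · exact (ExpBounded.eval r).add (((((ExpBounded.const 12).mul (.eval q)).add (.const 6)).add
      (.const 10)).add ((ExpBounded.eval q).mul (((ExpBounded.two_pow q).polynomial d).add
        (.const 2))))
  · intro w
    simp

theorem mem_SigmaEXP_succ_iff (j : ℕ) (L : Language Bool) :
    L ∈ SigmaEXP (j + 1) ↔
      ∃ (q : ℕ[X]) (R : (Fin (j + 2) → List Bool) → Prop), PolyTimeDecidable R ∧
        ∀ w : List Bool, w ∈ L ↔ AltQuant (2 ^ q.eval w.length) true (j + 1)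
          (fun v => R (Matrix.vecCons w v)) := by
  constructor
  · rintro ⟨A, hA, k, -, hL⟩
    obtain ⟨D, hD, p, h₁, h₂⟩ := verifiable_of_mem_NTIME j hA hL
    obtain ⟨R', hR', p', h₃⟩ := exists_altQuant_of_mem_SigmaP j hD
    obtain ⟨R, hR, h⟩ := exists_altQuant_of_verifiable (t := fun n => 2 ^ n ^ k) h₁ h₂ hR' h₃
    have ht : ExpBounded fun n => n + 2 ^ n ^ k := by
      simpa using (ExpBounded.eval Polynomial.X).add (.two_pow (Polynomial.X ^ k))
    have hp := ht.polynomial p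
    -- The length required by the quantifier description is a polynomial expression in n and
    -- 2^(n^k), hence at most 2^q(n) for some polynomial q; as any larger length is allowed, 2^q(n)
    -- itself serves.
    obtain ⟨q, hq⟩ := (((ExpBounded.const 2).mul hp).add (.const 1)).add
      (((((ExpBounded.const 2).mul (by simpa using ExpBounded.eval Polynomial.X)).add
        (.const 1)).add hp).polynomial p')
    exact ⟨q, R, polyTimeDecidable_iff.2 hR, fun w => h w _ (hq w.length)⟩
  · rintro ⟨q, R, hR, hL⟩
    obtain ⟨ℓ, T, hℓ, hT, hcomp⟩ := exists_comp_two_pow q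
    have hh : Poly fun p : List Bool × List Bool =>
        (false, pair p.1 (encodeWord p.2 ++ encodeWord p.1)) :=
      (Poly.const false).pair (Poly.pairWord.comp₂ Poly.fst
        (Poly.append.comp₂ (Poly.encodeWord.comp Poly.snd) (Poly.encodeWord.comp Poly.fst)))
    obtain ⟨r, hr⟩ := guess_mem_NTIME hcomp hh
    have hb : ExpBounded fun n => T n + r.eval (n + 2 ^ q.eval n) :=
      hT.add ((ExpBounded.add (by simpa using ExpBounded.eval Polynomial.X) (.two_pow q)).polynomial r)
    obtain ⟨k, hk, c, hc⟩ := hb.exists_le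
    let D : Language Bool := {u | ∃ x, u = encodeTuple x ∧ R x}
    -- The oracle is built from the complement of `D`, and the machine accepts on a negative answer:
    -- after w₁ the block starts with ∀.
    have hD : altLanguage j {u | u ∉ D} ∈ SigmaP j :=
      altLanguage_mem_SigmaP j (mem_P_of_polyPred (polyPred_of_mem_P hR).not)
    refine ⟨_, hD, k, hk, Eq.mpr (congrArg (· ∈ NTIME _ fun n => 2 ^ n ^ k) (Set.ext fun w => ?_))
      (hr (altLanguage j {u | u ∉ D}) (fun n => 2 ^ n ^ k)
        ⟨c, fun w => by rw [hℓ]; exact hc w.length⟩)⟩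
    change w ∈ L ↔ ∃ u : List Bool, _
    rw [hL]
    have h : ∀ v : Fin (j + 1) → List Bool,
        R (Matrix.vecCons w v) ↔ encodeWord w ++ encodeTuple v ∈ D := by
      intro v
      have e : encodeWord w ++ encodeTuple v = encodeTuple (Matrix.vecCons w v) :=
        (encodeTuple_cons w v).symm
      rw [e]
      exact ⟨fun h => ⟨_, rfl, h⟩, fun ⟨x, hx, h⟩ => encodeTuple_injective _ hx ▸ h⟩
    simp only [h]
    refine (altQuant_succ_iff j D _ (encodeWord w)).trans
      (exists_congr fun u => and_congr (by rw [hℓ]) ?_)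
    simp

end WeakEXP

theorem mainTheorem4 (i : ℕ) (hi : 0 < i) (L : Language Bool) :
    L ∈ WeakEXP.SigmaEXP i ↔
      ∃ (q : Polynomial ℕ) (R : (Fin (i + 1) → List Bool) → Prop),
        WeakEXP.PolyTimeDecidable R ∧
          ∀ w : List Bool, w ∈ L ↔
            WeakEXP.AltQuant (2 ^ q.eval w.length) true i
              (fun v => R (Matrix.vecCons w v)) := by
  obtain ⟨j, rfl⟩ : ∃ j, i = j + 1 := ⟨i - 1, by omega⟩
  exact WeakEXP.mem_SigmaEXP_succ_iff j L
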